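/- Let $G=(V,E)$ be a finite simple graph. Call $G$ bisplit if $V$ can be partitioned into three (possibly empty) stable sets $X, Y, Z$ such that every vertex of $Y$ is adjacent to every vertex of $Z$. When $G$ is connected, let $\rho$ be its shortest-path distance. A vertex $b$ is between $a$ and $c$ if $\rho(a,b)+\rho(b,c)=\rho(a,c)$, and three vertices are collinear if one of them is between the other two. For two distinct vertices $a,b$, the line generated by $a$ and $b$ is the set consisting of $a$, $b$ and all vertices $c$ such that $a,b,c$ are collinear. A line is universal if it equals $V$; lines are counted as distinct if they are distinct as subsets of $V$. Theorem. For every integer $n\ge 2$, every connected bisplit graph on $n$ vertices has a universal line or at least $n$ distinct lines. -/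

import Mathlib

namespace SimpleGraph

/-- In the shortest-path metric of `G`, the vertex `b` is between `a` and `c`. -/
def IsBetween {V : Type*} (G : SimpleGraph V) (a b c : V) : Prop :=
  G.dist a b + G.dist b c = G.dist a c

/-- Three vertices are collinear if one of them is between the other two. -/
def AreCollinear {V : Type*} (G : SimpleGraph V) (a b c : V) : Prop :=
  G.IsBetween a b c ∨ G.IsBetween b a c ∨ G.IsBetween a c b

/-- The line generated by `a` and `b`: the two vertices `a` and `b` together with all vertices
collinear with them. -/
def metricLine {V : Type*} (G : SimpleGraph V) (a b : V) : Set V :=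
  {a, b} ∪ {c | G.AreCollinear a b c}

/-- The set of all lines of `G`, as subsets of the vertex set. Equal lines with different
generators are counted once. -/
def metricLines {V : Type*} (G : SimpleGraph V) : Set (Set V) :=
  {L | ∃ a b : V, a ≠ b ∧ L = G.metricLine a b}

/-- `G` has a universal line: a line that consists of all vertices. -/
def HasUniversalLine {V : Type*} (G : SimpleGraph V) : Prop :=
  ∃ L ∈ G.metricLines, L = Set.univ

/-- The vertex set splits into three stable sets `X`, `Y`, `Z` (possibly empty) such that every
vertex of `Y` is adjacent to every vertex of `Z`. -/
def IsBisplit {V : Type*} (G : SimpleGraph V) : Prop :=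
  ∃ X Y Z : Set V, X ∪ Y ∪ Z = Set.univ ∧
    Disjoint X Y ∧ Disjoint X Z ∧ Disjoint Y Z ∧
    G.IsIndepSet X ∧ G.IsIndepSet Y ∧ G.IsIndepSet Z ∧
    ∀ y ∈ Y, ∀ z ∈ Z, G.Adj y z

end SimpleGraph

namespace SimpleGraph

variable {V : Type*} {G : SimpleGraph V} {X Y Z : Set V}

/-! If `Y` or `Z` is empty, the graph is bipartite and, by parity, the line of any edge is universal
(`Connected.hasUniversalLine_of_coloring`). Otherwise all distances are at most 4 and are determined
by adjacency to `Y` and `Z` and by sharing a neighbour, so the trace of a line on each class of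
vertices can be computed. Assume that no line is universal. Then `X.ncard` lines are charged to `X`,
and `Y.ncard + Z.ncard` further lines to `Y ∪ Z`.

For `X` (`exists_family_X`), each vertex falls into one of five classes: neighbours only in `Y`;
only in `Z`; mixed with a non-neighbour in `Y`; mixed, complete to `Y`, with a non-neighbour in `Z`;
complete to both. Except in the last class, `x` is joined to a suitable vertex of `Y ∪ Z`, and the
line determines `x` because it omits the competing vertices that share a neighbour with `x`. The
signatures record just enough of the traces to keep the classes apart, and their union `XSig` is
what every line charged to `Y ∪ Z` must avoid.

For `Y ∪ Z` (`exists_family_YZ`), let `Y` be the larger part. A part with at least three vertices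
supplies lines of pairs inside it, which meet that part in two vertices (`PairSig`). Smaller parts
mostly use lines containing all of `Y ∪ Z` (`WideSig`). Since such a line is not universal, some
vertex of `X` is missing from it, and these missing vertices show that the lines differ. A few small
cases need one extra line of another shape. -/

/-- `G` is connected, and `X`, `Y`, `Z` is a bisplit partition with `Y` and `Z` nonempty. -/
structure IsBisplitWith (G : SimpleGraph V) (X Y Z : Set V) : Prop where
  conn : G.Connected
  cover : ∀ v, v ∈ X ∨ v ∈ Y ∨ v ∈ Z
  disjXY : ∀ v, v ∈ X → v ∉ Y
  disjXZ : ∀ v, v ∈ X → v ∉ Z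
  disjYZ : ∀ v, v ∈ Y → v ∉ Z
  stableX : ∀ u ∈ X, ∀ v ∈ X, ¬ G.Adj u v
  stableY : ∀ u ∈ Y, ∀ v ∈ Y, ¬ G.Adj u v
  stableZ : ∀ u ∈ Z, ∀ v ∈ Z, ¬ G.Adj u v
  complete : ∀ y ∈ Y, ∀ z ∈ Z, G.Adj y z
  neY : Y.Nonempty
  neZ : Z.Nonempty

/-! ### Classes of vertices in `X`, collinearity and general distance facts. -/

/-- The vertices of `X` without neighbours in `S`. -/
def avoiding (G : SimpleGraph V) (X S : Set V) : Set V := {x | x ∈ X ∧ ∀ s ∈ S, ¬ G.Adj x s}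

/-- The vertices of `X` with neighbours in both `Y` and `Z`. -/
def mixed (G : SimpleGraph V) (X Y Z : Set V) : Set V :=
  {x | x ∈ X ∧ (∃ y ∈ Y, G.Adj x y) ∧ ∃ z ∈ Z, G.Adj x z}

/-- Two vertices share a neighbour. -/
def Share (G : SimpleGraph V) (u v : V) : Prop := ∃ w, G.Adj u w ∧ G.Adj v w

theorem Share.symm {u v : V} (h : G.Share u v) : G.Share v u := by
  obtain ⟨w, h1, h2⟩ := h
  exact ⟨w, h2, h1⟩

/-- The generators need no separate clause: a vertex is at distance 0 from itself, so each generator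
satisfies one of the equations. -/
theorem mem_metricLine {a b c : V} : c ∈ G.metricLine a b ↔
    G.dist a b + G.dist b c = G.dist a c ∨ G.dist a b + G.dist a c = G.dist b c ∨
      G.dist a c + G.dist b c = G.dist a b := by
  unfold metricLine AreCollinear IsBetween
  simp only [Set.mem_union, Set.mem_insert_iff, Set.mem_singleton_iff, Set.mem_ofPred_eq]
  rw [G.dist_comm (u := b) (v := a), G.dist_comm (u := c) (v := b)]
  constructor
  · rintro ((rfl | rfl) | h)
    · simp [G.dist_comm]
    · simp
    · exact h
  · exact Or.inr

theorem mem_metricLine_of_dist {a b c : V} {i j k : ℕ} (hi : G.dist a b = i) (hj : G.dist a c = j)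
    (hk : G.dist b c = k) : c ∈ G.metricLine a b ↔ i + k = j ∨ i + j = k ∨ j + k = i := by
  rw [mem_metricLine, hi, hj, hk]

theorem metricLine_comm (a b : V) : G.metricLine a b = G.metricLine b a := by
  ext c
  rw [mem_metricLine, mem_metricLine, G.dist_comm (u := b) (v := a)]
  omega

theorem left_mem_metricLine (a b : V) : a ∈ G.metricLine a b := Or.inl (Or.inl rfl)

theorem right_mem_metricLine (a b : V) : b ∈ G.metricLine a b := Or.inl (Or.inr rfl)

theorem Connected.exists_adj_dist_eq (hG : G.Connected) {u v : V} {k : ℕ}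
    (h : G.dist u v = k + 1) : ∃ w, G.Adj u w ∧ G.dist w v = k := by
  obtain ⟨p, hp⟩ := hG.exists_walk_length_eq_dist u v
  cases p with
  | nil => simp at h
  | @cons _ w _ hadj q =>
    refine ⟨w, hadj, ?_⟩
    rw [Walk.length_cons] at hp
    have h1 := dist_le q
    have h2 := hG.dist_triangle (u := u) (v := w) (w := v)
    rw [dist_eq_one_iff_adj.2 hadj] at h2
    omega

theorem Connected.dist_eq_two (hG : G.Connected) {u v : V} (hne : u ≠ v) (hadj : ¬ G.Adj u v)
    (hs : G.Share u v) : G.dist u v = 2 := by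
  obtain ⟨w, h1, h2⟩ := hs
  have ht := hG.dist_triangle (u := u) (v := w) (w := v)
  rw [dist_eq_one_iff_adj.2 h1, dist_eq_one_iff_adj.2 h2.symm] at ht
  have h0 := hG.pos_dist_of_ne hne
  have h3 : G.dist u v ≠ 1 := fun h => hadj (dist_eq_one_iff_adj.1 h)
  omega

theorem Connected.three_le_dist (hG : G.Connected) {u v : V} (hne : u ≠ v) (hadj : ¬ G.Adj u v)
    (hs : ¬ G.Share u v) : 3 ≤ G.dist u v := by
  have h0 := hG.pos_dist_of_ne hne
  have h3 : G.dist u v ≠ 1 := fun h => hadj (dist_eq_one_iff_adj.1 h)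
  have h4 : G.dist u v ≠ 2 := by
    intro h
    obtain ⟨w, h1, h2⟩ := hG.exists_adj_dist_eq h
    exact hs ⟨w, h1, (dist_eq_one_iff_adj.1 h2).symm⟩
  omega

namespace IsBisplitWith

theorem swap (h : G.IsBisplitWith X Y Z) : G.IsBisplitWith X Z Y where
  conn := h.conn
  cover v := by have := h.cover v; tauto
  disjXY := h.disjXZ
  disjXZ := h.disjXY
  disjYZ v hz hy := h.disjYZ v hy hz
  stableX := h.stableX
  stableY := h.stableZ
  stableZ := h.stableY
  complete z hz y hy := (h.complete y hy z hz).symm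
  neY := h.neZ
  neZ := h.neY

theorem ne_of_mem_YZ (h : G.IsBisplitWith X Y Z) {y z : V} (hy : y ∈ Y) (hz : z ∈ Z) : y ≠ z := by
  rintro rfl
  exact h.disjYZ _ hy hz

theorem ne_of_mem_XY (h : G.IsBisplitWith X Y Z) {x y : V} (hx : x ∈ X) (hy : y ∈ Y) : x ≠ y := by
  rintro rfl
  exact h.disjXY _ hx hy

theorem exists_adj (h : G.IsBisplitWith X Y Z) {x : V} (hx : x ∈ X) :
    (∃ y ∈ Y, G.Adj x y) ∨ ∃ z ∈ Z, G.Adj x z := by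
  obtain ⟨y, hy⟩ := h.neY
  have h0 := h.conn.pos_dist_of_ne (h.ne_of_mem_XY hx hy)
  obtain ⟨k, hk⟩ := Nat.exists_eq_succ_of_ne_zero h0.ne'
  obtain ⟨w, hw, -⟩ := h.conn.exists_adj_dist_eq hk
  rcases h.cover w with hX | hY | hZ
  · exact absurd hw (h.stableX _ hx _ hX)
  · exact Or.inl ⟨w, hY, hw⟩
  · exact Or.inr ⟨w, hZ, hw⟩

theorem mem_cases {x : V} (hx : x ∈ X) :
    x ∈ mixed G X Y Z ∨ x ∈ avoiding G X Z ∨ x ∈ avoiding G X Y := by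
  by_cases h1 : ∃ y ∈ Y, G.Adj x y
  · by_cases h2 : ∃ z ∈ Z, G.Adj x z
    · exact Or.inl ⟨hx, h1, h2⟩
    · push Not at h2
      exact Or.inr (Or.inl ⟨hx, h2⟩)
  · push Not at h1
    exact Or.inr (Or.inr ⟨hx, h1⟩)

theorem exists_adj_of_avoiding (h : G.IsBisplitWith X Y Z) {x : V} (hx : x ∈ avoiding G X Z) :
    ∃ y ∈ Y, G.Adj x y := by
  rcases h.exists_adj hx.1 with h1 | ⟨z, hz, hxz⟩
  · exact h1
  · exact absurd hxz (hx.2 z hz)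

theorem mem_Y_of_adj_avoiding (h : G.IsBisplitWith X Y Z) {x w : V} (hx : x ∈ avoiding G X Z)
    (hw : G.Adj x w) : w ∈ Y := by
  rcases h.cover w with hX | hY | hZ
  · exact absurd hw (h.stableX _ hx.1 _ hX)
  · exact hY
  · exact absurd hw (hx.2 w hZ)

/-! ### Distances in a bisplit graph. -/

theorem dist_YZ (h : G.IsBisplitWith X Y Z) {y z : V} (hy : y ∈ Y) (hz : z ∈ Z) :
    G.dist y z = 1 :=
  dist_eq_one_iff_adj.2 (h.complete y hy z hz)

theorem dist_YY (h : G.IsBisplitWith X Y Z) {y y' : V} (hy : y ∈ Y) (hy' : y' ∈ Y) (hne : y ≠ y') :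
    G.dist y y' = 2 := by
  obtain ⟨z, hz⟩ := h.neZ
  exact h.conn.dist_eq_two hne (h.stableY _ hy _ hy') ⟨z, h.complete _ hy _ hz, h.complete _ hy' _ hz⟩

theorem dist_XY_of_adj_Z (h : G.IsBisplitWith X Y Z) {x y : V} (hx : x ∈ X)
    (hz : ∃ z ∈ Z, G.Adj x z) (hy : y ∈ Y) (hxy : ¬ G.Adj x y) : G.dist x y = 2 := by
  obtain ⟨z, hz, hxz⟩ := hz
  exact h.conn.dist_eq_two (h.ne_of_mem_XY hx hy) hxy ⟨z, hxz, h.complete _ hy _ hz⟩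

theorem dist_avoiding_Z (h : G.IsBisplitWith X Y Z) {x z : V} (hx : x ∈ avoiding G X Z)
    (hz : z ∈ Z) : G.dist x z = 2 :=
  h.swap.dist_XY_of_adj_Z hx.1 (h.exists_adj_of_avoiding hx) hz (hx.2 z hz)

theorem dist_avoiding_Y (h : G.IsBisplitWith X Y Z) {x y : V} (hx : x ∈ avoiding G X Z)
    (hy : y ∈ Y) (hxy : ¬ G.Adj x y) : G.dist x y = 3 := by
  apply le_antisymm
  · obtain ⟨z, hz⟩ := h.neZ
    have := h.conn.dist_triangle (u := x) (v := z) (w := y)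
    rw [h.dist_avoiding_Z hx hz, h.swap.dist_YZ hz hy] at this
    exact this
  · apply h.conn.three_le_dist (h.ne_of_mem_XY hx.1 hy) hxy
    rintro ⟨w, h1, h2⟩
    exact h.stableY _ hy _ (h.mem_Y_of_adj_avoiding hx h1) h2

theorem dist_share (h : G.IsBisplitWith X Y Z) {x x' : V} (hx : x ∈ X) (hx' : x' ∈ X)
    (hne : x ≠ x') (hs : G.Share x x') : G.dist x x' = 2 :=
  h.conn.dist_eq_two hne (h.stableX _ hx _ hx') hs

theorem dist_not_share (h : G.IsBisplitWith X Y Z) {x x' : V} (hx : x ∈ X) (hx' : x' ∈ X)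
    (hne : x ≠ x') (hs : ¬ G.Share x x') (h1 : ∃ y ∈ Y, G.Adj x y) (h2 : ∃ z ∈ Z, G.Adj x' z) :
    G.dist x x' = 3 := by
  apply le_antisymm
  · obtain ⟨y, hy, hxy⟩ := h1
    obtain ⟨z, hz, hxz⟩ := h2
    have e1 := h.conn.dist_triangle (u := x) (v := y) (w := x')
    have e2 := h.conn.dist_triangle (u := y) (v := z) (w := x')
    rw [dist_eq_one_iff_adj.2 hxy] at e1
    rw [dist_eq_one_iff_adj.2 hxz.symm, h.dist_YZ hy hz] at e2
    omega
  · exact h.conn.three_le_dist hne (h.stableX _ hx _ hx') hs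

/-- A route through `Z` has length 2 + 2. Length 3 is impossible: the second vertex of a geodesic
lies in `Y` and is not adjacent to `x'`, hence is already at distance 3 from it. -/
theorem dist_avoiding_not_share (h : G.IsBisplitWith X Y Z) {x x' : V} (hx : x ∈ avoiding G X Z)
    (hx' : x' ∈ avoiding G X Z) (hne : x ≠ x') (hs : ¬ G.Share x x') : G.dist x x' = 4 := by
  have h3 := h.conn.three_le_dist hne (h.stableX _ hx.1 _ hx'.1) hs
  obtain ⟨z, hz⟩ := h.neZ
  have e1 := h.conn.dist_triangle (u := x) (v := z) (w := x')
  rw [h.dist_avoiding_Z hx hz, G.dist_comm (u := z), h.dist_avoiding_Z hx' hz] at e1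
  have h4 : G.dist x x' ≠ 3 := by
    intro e
    obtain ⟨w, hw, hd⟩ := h.conn.exists_adj_dist_eq e
    have hwY := h.mem_Y_of_adj_avoiding hx hw
    have hn : ¬ G.Adj x' w := fun ha => hs ⟨w, hw, ha⟩
    rw [G.dist_comm, h.dist_avoiding_Y hx' hwY hn] at hd
    omega
  omega

theorem dist_mixed_X (h : G.IsBisplitWith X Y Z) {x x' : V} (hx : x ∈ mixed G X Y Z) (hx' : x' ∈ X)
    (hne : x ≠ x') : G.dist x x' = 2 ∨ G.dist x x' = 3 := by
  by_cases hs : G.Share x x'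
  · exact Or.inl (h.dist_share hx.1 hx' hne hs)
  · right
    rcases h.exists_adj hx' with h1 | h1
    · exact h.swap.dist_not_share hx.1 hx' hne hs hx.2.2 h1
    · exact h.dist_not_share hx.1 hx' hne hs hx.2.1 h1

theorem mixed_swap {x : V} (hx : x ∈ mixed G X Y Z) : x ∈ mixed G X Z Y := ⟨hx.1, hx.2.2, hx.2.1⟩

/-! ### Lines generated by a vertex of `Y` and a vertex of `Z` -/

theorem lineYZ_mem_Y (h : G.IsBisplitWith X Y Z) {y z c : V} (hy : y ∈ Y) (hz : z ∈ Z)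
    (hc : c ∈ Y) : c ∈ G.metricLine y z := by
  by_cases e : c = y
  · subst e; exact left_mem_metricLine _ _
  · rw [mem_metricLine_of_dist (h.dist_YZ hy hz) (h.dist_YY hy hc (Ne.symm e))
      (h.swap.dist_YZ hz hc)]
    omega

theorem lineYZ_mem_Z (h : G.IsBisplitWith X Y Z) {y z c : V} (hy : y ∈ Y) (hz : z ∈ Z)
    (hc : c ∈ Z) : c ∈ G.metricLine y z := by
  rw [metricLine_comm]
  exact h.swap.lineYZ_mem_Y hz hy hc

theorem lineYZ_mem_avoiding_Z (h : G.IsBisplitWith X Y Z) {y z c : V} (hy : y ∈ Y) (hz : z ∈ Z)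
    (hc : c ∈ avoiding G X Z) : c ∈ G.metricLine y z := by
  have e2 : G.dist z c = 2 := by rw [G.dist_comm, h.dist_avoiding_Z hc hz]
  by_cases e : G.Adj c y
  · rw [mem_metricLine_of_dist (h.dist_YZ hy hz) (dist_eq_one_iff_adj.2 e.symm) e2]
    omega
  · have e1 := h.dist_avoiding_Y hc hy e
    rw [G.dist_comm] at e1
    rw [mem_metricLine_of_dist (h.dist_YZ hy hz) e1 e2]
    omega

theorem lineYZ_mem_avoiding_Y (h : G.IsBisplitWith X Y Z) {y z c : V} (hy : y ∈ Y) (hz : z ∈ Z)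
    (hc : c ∈ avoiding G X Y) : c ∈ G.metricLine y z := by
  rw [metricLine_comm]
  exact h.swap.lineYZ_mem_avoiding_Z hz hy hc

theorem dist_mixed_Y (h : G.IsBisplitWith X Y Z) {x y : V} (hx : x ∈ mixed G X Y Z) (hy : y ∈ Y) :
    G.Adj x y ∧ G.dist y x = 1 ∨ ¬ G.Adj x y ∧ G.dist y x = 2 := by
  by_cases e : G.Adj x y
  · exact Or.inl ⟨e, dist_eq_one_iff_adj.2 e.symm⟩
  · exact Or.inr ⟨e, by rw [G.dist_comm]; exact h.dist_XY_of_adj_Z hx.1 hx.2.2 hy e⟩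

theorem lineYZ_mem_mixed (h : G.IsBisplitWith X Y Z) {y z c : V} (hy : y ∈ Y) (hz : z ∈ Z)
    (hc : c ∈ mixed G X Y Z) : c ∈ G.metricLine y z ↔ (G.Adj c y ↔ ¬ G.Adj c z) := by
  rcases h.dist_mixed_Y hc hy with ⟨a1, e1⟩ | ⟨a1, e1⟩ <;>
  rcases h.swap.dist_mixed_Y (mixed_swap hc) hz with ⟨a2, e2⟩ | ⟨a2, e2⟩ <;>
  · rw [mem_metricLine_of_dist (h.dist_YZ hy hz) e1 e2]
    simp [a1, a2]

/-! ### Lines generated by two vertices of `Y` -/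

theorem lineYY_mem_Y (h : G.IsBisplitWith X Y Z) {y y' c : V} (hy : y ∈ Y) (hy' : y' ∈ Y)
    (hne : y ≠ y') (hc : c ∈ Y) : c ∈ G.metricLine y y' ↔ c = y ∨ c = y' := by
  by_cases e : c = y
  · subst e; simp [left_mem_metricLine]
  by_cases e' : c = y'
  · subst e'; simp [right_mem_metricLine]
  rw [mem_metricLine_of_dist (h.dist_YY hy hy' hne) (h.dist_YY hy hc (Ne.symm e))
    (h.dist_YY hy' hc (Ne.symm e'))]
  simp [e, e']

theorem lineYY_mem_Z (h : G.IsBisplitWith X Y Z) {y y' c : V} (hy : y ∈ Y) (hy' : y' ∈ Y)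
    (hne : y ≠ y') (hc : c ∈ Z) : c ∈ G.metricLine y y' := by
  rw [mem_metricLine_of_dist (h.dist_YY hy hy' hne) (h.dist_YZ hy hc) (h.dist_YZ hy' hc)]
  omega

theorem lineYY_mem_mixed (h : G.IsBisplitWith X Y Z) {y y' c : V} (hy : y ∈ Y) (hy' : y' ∈ Y)
    (hne : y ≠ y') (hc : c ∈ mixed G X Y Z) :
    c ∈ G.metricLine y y' ↔ G.Adj c y ∧ G.Adj c y' := by
  rcases h.dist_mixed_Y hc hy with ⟨a1, e1⟩ | ⟨a1, e1⟩ <;>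
  rcases h.dist_mixed_Y hc hy' with ⟨a2, e2⟩ | ⟨a2, e2⟩ <;>
  · rw [mem_metricLine_of_dist (h.dist_YY hy hy' hne) e1 e2]
    simp [a1, a2]

theorem lineYY_mem_avoiding_Z (h : G.IsBisplitWith X Y Z) {y y' c : V} (hy : y ∈ Y) (hy' : y' ∈ Y)
    (hne : y ≠ y') (hadj : G.Adj c y ∧ G.Adj c y') :
    c ∈ G.metricLine y y' := by
  rw [mem_metricLine_of_dist (h.dist_YY hy hy' hne) (dist_eq_one_iff_adj.2 hadj.1.symm)
    (dist_eq_one_iff_adj.2 hadj.2.symm)]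
  omega

theorem lineYY_notMem_avoiding_Y (h : G.IsBisplitWith X Y Z) {y y' c : V} (hy : y ∈ Y)
    (hy' : y' ∈ Y) (hne : y ≠ y') (hc : c ∈ avoiding G X Y) : c ∉ G.metricLine y y' := by
  have e1 := h.swap.dist_avoiding_Z hc hy
  have e2 := h.swap.dist_avoiding_Z hc hy'
  rw [G.dist_comm] at e1 e2
  rw [mem_metricLine_of_dist (h.dist_YY hy hy' hne) e1 e2]
  omega

/-! ### Lines generated by two vertices of `X` sharing a neighbour -/

theorem lineXX_mem_Y (h : G.IsBisplitWith X Y Z) {x x' c : V} (hx : x ∈ mixed G X Y Z)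
    (hx' : x' ∈ mixed G X Y Z) (hne : x ≠ x') (hs : G.Share x x') (hc : c ∈ Y) :
    c ∈ G.metricLine x x' ↔ G.Adj x c ∧ G.Adj x' c := by
  rcases h.dist_mixed_Y hx hc with ⟨a1, e1⟩ | ⟨a1, e1⟩ <;>
  rcases h.dist_mixed_Y hx' hc with ⟨a2, e2⟩ | ⟨a2, e2⟩ <;>
  · rw [G.dist_comm] at e1 e2
    rw [mem_metricLine_of_dist (h.dist_share hx.1 hx'.1 hne hs) e1 e2]
    simp [a1, a2]

/-- A third vertex of `X` is at distance 2 or 3 from each generator, and the generators are at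
distance 2; no such triple is additive. -/
theorem lineXX_mem_X (h : G.IsBisplitWith X Y Z) {x x' c : V} (hx : x ∈ mixed G X Y Z)
    (hx' : x' ∈ mixed G X Y Z) (hne : x ≠ x') (hs : G.Share x x') (hc : c ∈ X) :
    c ∈ G.metricLine x x' ↔ c = x ∨ c = x' := by
  by_cases e : c = x
  · subst e; simp [left_mem_metricLine]
  by_cases e' : c = x'
  · subst e'; simp [right_mem_metricLine]
  rcases h.dist_mixed_X hx hc (Ne.symm e) with e1 | e1 <;>
  rcases h.dist_mixed_X hx' hc (Ne.symm e') with e2 | e2 <;>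
  · rw [mem_metricLine_of_dist (h.dist_share hx.1 hx'.1 hne hs) e1 e2]
    simp [e, e']

/-! ### Lines generated by a vertex with neighbours in both parts and a vertex of `Y` -/

theorem lineXY_adj_mem_Y (h : G.IsBisplitWith X Y Z) {x y c : V} (hxy : G.Adj x y) (hy : y ∈ Y)
    (hc : c ∈ Y) (hxc : G.Adj x c) : c ∈ G.metricLine x y := by
  by_cases e : c = y
  · subst e; exact right_mem_metricLine _ _
  rw [mem_metricLine_of_dist (dist_eq_one_iff_adj.2 hxy) (dist_eq_one_iff_adj.2 hxc)
    (h.dist_YY hy hc (Ne.symm e))]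
  omega

theorem lineXY_adj_notMem_Z (h : G.IsBisplitWith X Y Z) {x y c : V} (hxy : G.Adj x y) (hy : y ∈ Y)
    (hc : c ∈ Z) (hxc : G.Adj x c) : c ∉ G.metricLine x y := by
  rw [mem_metricLine_of_dist (dist_eq_one_iff_adj.2 hxy) (dist_eq_one_iff_adj.2 hxc)
    (h.dist_YZ hy hc)]
  omega

theorem lineXY_mem_Y (h : G.IsBisplitWith X Y Z) {x y c : V} (hx : x ∈ mixed G X Y Z) (hy : y ∈ Y)
    (hxy : ¬ G.Adj x y) (hc : c ∈ Y) : c ∈ G.metricLine x y ↔ c = y := by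
  by_cases e : c = y
  · subst e; simp [right_mem_metricLine]
  rcases h.dist_mixed_Y hx hc with ⟨a1, e1⟩ | ⟨a1, e1⟩ <;>
  · rw [G.dist_comm] at e1
    rw [mem_metricLine_of_dist (h.dist_XY_of_adj_Z hx.1 hx.2.2 hy hxy) e1
      (h.dist_YY hy hc (Ne.symm e))]
    simp [e]

theorem lineXY_mem_Z (h : G.IsBisplitWith X Y Z) {x y c : V} (hx : x ∈ mixed G X Y Z) (hy : y ∈ Y)
    (hxy : ¬ G.Adj x y) (hc : c ∈ Z) : c ∈ G.metricLine x y ↔ G.Adj x c := by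
  rcases h.swap.dist_mixed_Y (mixed_swap hx) hc with ⟨a1, e1⟩ | ⟨a1, e1⟩ <;>
  · rw [G.dist_comm] at e1
    rw [mem_metricLine_of_dist (h.dist_XY_of_adj_Z hx.1 hx.2.2 hy hxy) e1 (h.dist_YZ hy hc)]
    simp [a1]

theorem lineXY_notMem_avoiding_Y (h : G.IsBisplitWith X Y Z) {x y c : V} (hx : x ∈ mixed G X Y Z)
    (hy : y ∈ Y) (hxy : ¬ G.Adj x y) (hc : c ∈ avoiding G X Y) : c ∉ G.metricLine x y := by
  have e2 := h.swap.dist_avoiding_Z hc hy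
  rw [G.dist_comm] at e2
  have hne : x ≠ c := by
    rintro rfl
    obtain ⟨y, hy, ha⟩ := hx.2.1
    exact hc.2 y hy ha
  rcases h.dist_mixed_X hx hc.1 hne with e1 | e1 <;>
  · rw [mem_metricLine_of_dist (h.dist_XY_of_adj_Z hx.1 hx.2.2 hy hxy) e1 e2]
    omega

/-- Here `x` is at distance 2 from both `y` and `c`, so collinearity would require `c` and `y` to be
at distance 4 or 0. -/
theorem lineXY_notMem_of_share (h : G.IsBisplitWith X Y Z) {x y c : V} (hx : x ∈ mixed G X Y Z)
    (hy : y ∈ Y) (hxy : ¬ G.Adj x y) (hc : c ∈ X) (hne : x ≠ c) (hs : G.Share x c) :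
    c ∉ G.metricLine x y := by
  have e0 := h.dist_XY_of_adj_Z hx.1 hx.2.2 hy hxy
  have e1 := h.dist_share hx.1 hc hne hs
  have h0 := h.conn.pos_dist_of_ne (h.ne_of_mem_XY hc hy)
  have h1 : G.dist c y ≠ 4 := by
    rcases mem_cases hc with hm | hm | hm
    · rcases h.dist_mixed_Y hm hy with ⟨a, e⟩ | ⟨a, e⟩ <;>
      · rw [G.dist_comm, e]; omega
    · by_cases a : G.Adj c y
      · rw [dist_eq_one_iff_adj.2 a]; omega
      · rw [h.dist_avoiding_Y hm hy a]; omega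
    · rw [h.swap.dist_avoiding_Z hm hy]; omega
  rw [mem_metricLine_of_dist e0 e1 rfl]
  rw [G.dist_comm] at h0 h1
  omega

/-! ### Lines generated by a vertex without neighbours in `Z` and a vertex of `Z` -/

theorem lineAZ_mem_Y (h : G.IsBisplitWith X Y Z) {x z c : V} (hx : x ∈ avoiding G X Z) (hz : z ∈ Z)
    (hc : c ∈ Y) : c ∈ G.metricLine x z := by
  by_cases a : G.Adj x c
  · rw [mem_metricLine_of_dist (h.dist_avoiding_Z hx hz) (dist_eq_one_iff_adj.2 a)
      (h.swap.dist_YZ hz hc)]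
    omega
  · rw [mem_metricLine_of_dist (h.dist_avoiding_Z hx hz) (h.dist_avoiding_Y hx hc a)
      (h.swap.dist_YZ hz hc)]
    omega

theorem lineAZ_mem_Z (h : G.IsBisplitWith X Y Z) {x z c : V} (hx : x ∈ avoiding G X Z) (hz : z ∈ Z)
    (hc : c ∈ Z) : c ∈ G.metricLine x z ↔ c = z := by
  by_cases e : c = z
  · subst e; simp [right_mem_metricLine]
  rw [mem_metricLine_of_dist (h.dist_avoiding_Z hx hz) (h.dist_avoiding_Z hx hc)
      (h.swap.dist_YY hz hc (Ne.symm e))]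
  simp [e]

theorem lineAZ_notMem_of_share (h : G.IsBisplitWith X Y Z) {x z c : V} (hx : x ∈ avoiding G X Z)
    (hz : z ∈ Z) (hc : c ∈ avoiding G X Z) (hne : x ≠ c) (hs : G.Share x c) :
    c ∉ G.metricLine x z := by
  have e2 := h.dist_avoiding_Z hc hz
  rw [G.dist_comm] at e2
  rw [mem_metricLine_of_dist (h.dist_avoiding_Z hx hz) (h.dist_share hx.1 hc.1 hne hs) e2]
  omega

theorem lineAZ_notMem_mixed (h : G.IsBisplitWith X Y Z) {x z c : V} (hx : x ∈ avoiding G X Z)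
    (hz : z ∈ Z) (hc : c ∈ mixed G X Y Z) (hs : G.Share x c) :
    c ∉ G.metricLine x z := by
  have hne : x ≠ c := by
    rintro rfl
    obtain ⟨z, hz, ha⟩ := hc.2.2
    exact hx.2 z hz ha
  rcases h.swap.dist_mixed_Y (mixed_swap hc) hz with ⟨a, e⟩ | ⟨a, e⟩ <;>
  · rw [mem_metricLine_of_dist (h.dist_avoiding_Z hx hz) (h.dist_share hx.1 hc.1 hne hs) e]
    omega

/-! ### Lines generated by a vertex without neighbours in `Z` and a vertex of `Y` -/

theorem lineAY_mem_Y (h : G.IsBisplitWith X Y Z) {x y c : V} (hx : x ∈ avoiding G X Z) (hy : y ∈ Y)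
    (hxy : ¬ G.Adj x y) (hc : c ∈ Y) : c ∈ G.metricLine x y ↔ G.Adj x c ∨ c = y := by
  by_cases e : c = y
  · subst e; simp [right_mem_metricLine]
  by_cases a : G.Adj x c
  · rw [mem_metricLine_of_dist (h.dist_avoiding_Y hx hy hxy) (dist_eq_one_iff_adj.2 a)
      (h.dist_YY hy hc (Ne.symm e))]
    simp [a]
  · rw [mem_metricLine_of_dist (h.dist_avoiding_Y hx hy hxy) (h.dist_avoiding_Y hx hc a)
      (h.dist_YY hy hc (Ne.symm e))]
    simp [a, e]

theorem lineAY_mem_Z (h : G.IsBisplitWith X Y Z) {x y c : V} (hx : x ∈ avoiding G X Z) (hy : y ∈ Y)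
    (hxy : ¬ G.Adj x y) (hc : c ∈ Z) : c ∈ G.metricLine x y := by
  rw [mem_metricLine_of_dist (h.dist_avoiding_Y hx hy hxy) (h.dist_avoiding_Z hx hc)
    (h.dist_YZ hy hc)]
  omega

theorem lineAY_notMem_avoiding_Y (h : G.IsBisplitWith X Y Z) {x y c : V} (hx : x ∈ avoiding G X Z)
    (hy : y ∈ Y) (hxy : ¬ G.Adj x y) (hc : c ∈ avoiding G X Y) : c ∉ G.metricLine x y := by
  have hs : ¬ G.Share x c := by
    rintro ⟨w, h1, h2⟩
    exact hc.2 w (h.mem_Y_of_adj_avoiding hx h1) h2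
  have hne : x ≠ c := by
    rintro rfl
    obtain ⟨y, hy, ha⟩ := h.exists_adj_of_avoiding hx
    exact hc.2 y hy ha
  have e1 := h.dist_not_share hx.1 hc.1 hne hs (h.exists_adj_of_avoiding hx)
    (h.swap.exists_adj_of_avoiding hc)
  have e2 := h.swap.dist_avoiding_Z hc hy
  rw [G.dist_comm] at e2
  rw [mem_metricLine_of_dist (h.dist_avoiding_Y hx hy hxy) e1 e2]
  omega

theorem lineAY_notMem_avoiding_Z (h : G.IsBisplitWith X Y Z) {x y c : V} (hx : x ∈ avoiding G X Z)
    (hy : y ∈ Y) (hxy : ¬ G.Adj x y) (hc : c ∈ avoiding G X Z) (hne : x ≠ c) (hcy : ¬ G.Adj c y) :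
    c ∉ G.metricLine x y := by
  have e2 := h.dist_avoiding_Y hc hy hcy
  rw [G.dist_comm] at e2
  by_cases hs : G.Share x c
  · rw [mem_metricLine_of_dist (h.dist_avoiding_Y hx hy hxy) (h.dist_share hx.1 hc.1 hne hs) e2]
    omega
  · rw [mem_metricLine_of_dist (h.dist_avoiding_Y hx hy hxy)
      (h.dist_avoiding_not_share hx hc hne hs) e2]
    omega

theorem lineAY_adj_mem_Y (h : G.IsBisplitWith X Y Z) {x y c : V} (hx : x ∈ avoiding G X Z)
    (hy : y ∈ Y) (hxy : G.Adj x y) (hc : c ∈ Y) : c ∈ G.metricLine x y := by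
  by_cases a : G.Adj x c
  · exact h.lineXY_adj_mem_Y hxy hy hc a
  · have e : c ≠ y := by
      rintro rfl
      exact a hxy
    rw [mem_metricLine_of_dist (dist_eq_one_iff_adj.2 hxy) (h.dist_avoiding_Y hx hc a)
      (h.dist_YY hy hc e.symm)]
    omega

theorem lineAY_adj_mem_Z (h : G.IsBisplitWith X Y Z) {x y c : V} (hx : x ∈ avoiding G X Z)
    (hy : y ∈ Y) (hxy : G.Adj x y) (hc : c ∈ Z) : c ∈ G.metricLine x y := by
  rw [mem_metricLine_of_dist (dist_eq_one_iff_adj.2 hxy) (h.dist_avoiding_Z hx hc)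
    (h.dist_YZ hy hc)]
  omega

theorem lineAY_adj_mem_avoiding_Z (h : G.IsBisplitWith X Y Z) {x y c : V}
    (hx : x ∈ avoiding G X Z) (hy : y ∈ Y) (hxy : G.Adj x y) (hc : c ∈ avoiding G X Z) :
    c ∈ G.metricLine x y := by
  by_cases hne : x = c
  · subst hne; exact left_mem_metricLine _ _
  have e0 := dist_eq_one_iff_adj.2 hxy
  by_cases a : G.Adj c y
  · rw [mem_metricLine_of_dist e0 (h.dist_share hx.1 hc.1 hne ⟨y, hxy, a⟩)
      (dist_eq_one_iff_adj.2 a.symm)]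
    omega
  · have e2 := h.dist_avoiding_Y hc hy a
    rw [G.dist_comm] at e2
    by_cases hs : G.Share x c
    · rw [mem_metricLine_of_dist e0 (h.dist_share hx.1 hc.1 hne hs) e2]
      omega
    · rw [mem_metricLine_of_dist e0 (h.dist_avoiding_not_share hx hc hne hs) e2]
      omega

theorem lineAY_adj_mem_avoiding_Y (h : G.IsBisplitWith X Y Z) {x y c : V}
    (hx : x ∈ avoiding G X Z) (hy : y ∈ Y) (hxy : G.Adj x y) (hc : c ∈ avoiding G X Y) :
    c ∈ G.metricLine x y := by
  have hs : ¬ G.Share x c := by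
    rintro ⟨w, h1, h2⟩
    exact hc.2 w (h.mem_Y_of_adj_avoiding hx h1) h2
  have hne : x ≠ c := by
    rintro rfl
    exact hc.2 y hy hxy
  have e1 := h.dist_not_share hx.1 hc.1 hne hs ⟨y, hy, hxy⟩ (h.swap.exists_adj_of_avoiding hc)
  have e2 := h.swap.dist_avoiding_Z hc hy
  rw [G.dist_comm] at e2
  rw [mem_metricLine_of_dist (dist_eq_one_iff_adj.2 hxy) e1 e2]
  omega

theorem lineAY_adj_mem_mixed (h : G.IsBisplitWith X Y Z) {x y c : V}
    (hx : x ∈ avoiding G X Z) (hy : y ∈ Y) (hxy : G.Adj x y) (hc : c ∈ mixed G X Y Z) :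
    c ∈ G.metricLine x y ↔ G.Adj c y ∨ ¬ G.Share x c := by
  have hne : x ≠ c := by
    rintro rfl
    obtain ⟨z, hz, ha⟩ := hc.2.2
    exact hx.2 z hz ha
  have e0 := dist_eq_one_iff_adj.2 hxy
  rcases h.dist_mixed_Y hc hy with ⟨a, e2⟩ | ⟨a, e2⟩
  · rw [mem_metricLine_of_dist e0 (h.dist_share hx.1 hc.1 hne ⟨y, hxy, a⟩) e2]
    simp [a]
  · by_cases hs : G.Share x c
    · rw [mem_metricLine_of_dist e0 (h.dist_share hx.1 hc.1 hne hs) e2]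
      simp [a, hs]
    · rw [mem_metricLine_of_dist e0 (h.dist_not_share hx.1 hc.1 hne hs ⟨y, hy, hxy⟩ hc.2.2) e2]
      simp [a, hs]

end IsBisplitWith

/-! ### Signatures and families of lines charged to `X`. -/

/-- The vertices of `X` adjacent to all of `Y` and `Z`. -/
def fullTo (G : SimpleGraph V) (X Y Z : Set V) : Set V :=
  {x | x ∈ X ∧ (∀ y ∈ Y, G.Adj x y) ∧ ∀ z ∈ Z, G.Adj x z}

theorem metricLine_mem_metricLines {a b : V} (hne : a ≠ b) : G.metricLine a b ∈ G.metricLines :=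
  ⟨a, b, hne, rfl⟩

/-- `R x L` records how `L` was obtained from `x`; if it determines `x`, choosing one line per
vertex is injective. -/
theorem exists_family [Finite V] {S : Set V} {P : Set V → Prop} {R : V → Set V → Prop}
    (hex : ∀ x ∈ S, ∃ L ∈ G.metricLines, P L ∧ R x L)
    (hinj : ∀ x ∈ S, ∀ x' ∈ S, ∀ L, R x L → R x' L → x = x') :
    ∃ 𝓐 ⊆ G.metricLines, S.ncard ≤ 𝓐.ncard ∧ ∀ L ∈ 𝓐, P L := by
  choose! f hf using hex
  refine ⟨f '' S, ?_, ?_, ?_⟩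
  · rintro _ ⟨x, hx, rfl⟩
    exact (hf x hx).1
  · rw [Set.InjOn.ncard_image]
    intro x hx x' hx' e
    have h1 := (hf x hx).2.2
    rw [e] at h1
    exact hinj x hx x' hx' _ h1 (hf x' hx').2.2
  · rintro _ ⟨x, hx, rfl⟩
    exact (hf x hx).2.1

theorem exists_family_union [Finite V] {P Q : Set V → Prop} {k l : ℕ}
    (h1 : ∃ 𝓐 ⊆ G.metricLines, k ≤ 𝓐.ncard ∧ ∀ L ∈ 𝓐, P L)
    (h2 : ∃ 𝓐 ⊆ G.metricLines, l ≤ 𝓐.ncard ∧ ∀ L ∈ 𝓐, Q L) (hPQ : ∀ L, P L → ¬ Q L) :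
    ∃ 𝓐 ⊆ G.metricLines, k + l ≤ 𝓐.ncard ∧ ∀ L ∈ 𝓐, P L ∨ Q L := by
  obtain ⟨A, hA, hk, hP⟩ := h1
  obtain ⟨B, hB, hl, hQ⟩ := h2
  refine ⟨A ∪ B, Set.union_subset hA hB, ?_, ?_⟩
  · rw [Set.ncard_union_eq (Set.disjoint_left.2 fun L h1 h2 => hPQ L (hP L h1) (hQ L h2))]
    omega
  · rintro L (hL | hL)
    · exact Or.inl (hP L hL)
    · exact Or.inr (hQ L hL)

/-- If lines generated by pairs in `S` have trace exactly that pair on `S`, and `S` has at least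
three elements, then these pairs generate at least as many lines as `S` has elements. -/
theorem exists_family_pairs [Finite V] {S : Set V} (hS : 3 ≤ S.ncard)
    (htr : ∀ u ∈ S, ∀ v ∈ S, u ≠ v → ∀ c ∈ S, c ∈ G.metricLine u v ↔ c = u ∨ c = v) :
    ∃ 𝓐 ⊆ G.metricLines, S.ncard ≤ 𝓐.ncard ∧
      ∀ L ∈ 𝓐, ∃ u ∈ S, ∃ v ∈ S, u ≠ v ∧ L = G.metricLine u v := by
  classical
  obtain ⟨a, ha, b, hb, c, hc, hab, hac, hbc⟩ := (Set.two_lt_ncard (Set.toFinite S)).1 hS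
  have key : ∀ u ∈ S, ∀ v ∈ S, u ≠ v → ∃ L ∈ G.metricLines,
      (∃ u ∈ S, ∃ v ∈ S, u ≠ v ∧ L = G.metricLine u v) ∧ (∀ w ∈ S, w ∈ L ↔ w = u ∨ w = v) :=
    fun u hu v hv hne => ⟨_, metricLine_mem_metricLines hne, ⟨u, hu, v, hv, hne, rfl⟩,
      htr u hu v hv hne⟩
  -- The pairs form a star at `a`, with `{a, x}` assigned to each `x ≠ a`, and the leftover `a`
  -- receives `{b, c}`.
  apply exists_family (R := fun x L => ∀ w ∈ S, w ∈ L ↔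
    w = (if x = a then b else a) ∨ w = if x = a then c else x)
  · intro x hx
    by_cases e : x = a
    · simpa [e] using key b hb c hc hbc
    · simpa [e] using key a ha x hx (Ne.symm e)
  · intro x hx x' hx' L h1 h2
    have e1 := (h1 x hx).symm.trans (h2 x hx)
    have e2 := (h1 x' hx').symm.trans (h2 x' hx')
    have e3 := (h1 a ha).symm.trans (h2 a ha)
    by_cases i : x = a <;> by_cases j : x' = a
    · rw [i, j]
    · simp [i, j, hab, hac] at e3
    · simp [i, j, hab, hac] at e3
    · simpa [i, j] using e1

/-- Signature of the lines chosen for vertices of `X` with neighbours in `Y` only. -/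
def AvoidingSig (G : SimpleGraph V) (X Y Z : Set V) (y₀ : V) (L : Set V) : Prop :=
  (∃ x ∈ avoiding G X Z, x ∈ L) ∧ (∀ u, ∃ w ∈ Y, w ∈ L ∧ w ≠ u) ∧ ∃ z₀ ∈ Z, z₀ ∈ L ∧
    ((Y ⊆ L ∧ (∀ z ∈ Z, z ∈ L → z = z₀) ∧ (∃ x ∈ avoiding G X Z, L = G.metricLine x z₀) ∧
        ∀ z ∈ Z, G.metricLine y₀ z ≠ L) ∨
      (¬ Y ⊆ L ∧ Z ⊆ L ∧ (∀ u v, ∃ w ∈ Y, w ∈ L ∧ w ≠ u ∧ w ≠ v) ∧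
        ∀ c ∈ avoiding G X Y, c ∉ L))

/-- Signature of the lines chosen for vertices of `X` with a non-neighbour in `Y`. -/
def PartialSig (G : SimpleGraph V) (X Y Z : Set V) (L : Set V) : Prop :=
  (∃ y ∈ Y, ∀ c ∈ Y, c ∈ L ↔ c = y) ∧ ¬ Y ⊆ L ∧ (∃ z ∈ Z, z ∈ L) ∧
    (∀ c ∈ avoiding G X Y, c ∉ L) ∧ ∀ c ∈ fullTo G X Y Z, c ∉ L

/-- Signature of the lines chosen for vertices of `X` adjacent to all of `Y`, with a non-neighbour
in `Z`. -/
def HalfSig (G : SimpleGraph V) (X Y Z : Set V) (L : Set V) : Prop :=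
  Y ⊆ L ∧ (∃ z ∈ Z, ∀ c ∈ Z, c ∈ L ↔ c = z) ∧ ¬ Z ⊆ L ∧
    (∀ c ∈ avoiding G X Z, c ∉ L) ∧ ∀ c ∈ fullTo G X Y Z, c ∉ L

/-- Signature of the lines chosen for vertices of `X` adjacent to all of `Y` and `Z`. -/
def FullSig (G : SimpleGraph V) (X Y Z : Set V) (L : Set V) : Prop :=
  (3 ≤ (fullTo G X Y Z).ncard ∧ Y ⊆ L ∧ Z ⊆ L ∧ ∃ x ∈ fullTo G X Y Z, ∃ x' ∈ fullTo G X Y Z,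
    x ≠ x' ∧ ∀ c ∈ X, c ∈ L ↔ c = x ∨ c = x') ∨
  ((fullTo G X Y Z).ncard ≤ 2 ∧ Y ⊆ L ∧ (∀ z ∈ Z, z ∉ L) ∧ ∃ x ∈ fullTo G X Y Z, x ∈ L) ∨
  ((fullTo G X Y Z).ncard = 2 ∧ Z ⊆ L ∧ (∀ y ∈ Y, y ∉ L) ∧ ∃ x ∈ fullTo G X Y Z, x ∈ L)

/-- The signatures of the lines chosen for the vertices of `X`. -/
def XSig (G : SimpleGraph V) (X Y Z : Set V) (y₀ z₀ : V) (L : Set V) : Prop :=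
  (((AvoidingSig G X Y Z y₀ L ∨ AvoidingSig G X Z Y z₀ L) ∨ PartialSig G X Y Z L) ∨
    HalfSig G X Y Z L) ∨ FullSig G X Y Z L

namespace IsBisplitWith

theorem fullTo_subset_mixed (h : G.IsBisplitWith X Y Z) {x : V} (hx : x ∈ fullTo G X Y Z) :
    x ∈ mixed G X Y Z := by
  obtain ⟨y, hy⟩ := h.neY
  obtain ⟨z, hz⟩ := h.neZ
  exact ⟨hx.1, ⟨y, hy, hx.2.1 y hy⟩, ⟨z, hz, hx.2.2 z hz⟩⟩

theorem share_fullTo (h : G.IsBisplitWith X Y Z) {x x' : V} (hx : x ∈ fullTo G X Y Z)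
    (hx' : x' ∈ X) : G.Share x x' := by
  rcases h.exists_adj hx' with ⟨y, hy, ha⟩ | ⟨y, hy, ha⟩
  · exact ⟨y, hx.2.1 y hy, ha⟩
  · exact ⟨y, hx.2.2 y hy, ha⟩

/-- The only vertices that such a line can miss are mixed ones that share a neighbour with `x`
without being adjacent to `y`. This is the main source of universal lines. -/
theorem lineAY_adj_eq_univ (h : G.IsBisplitWith X Y Z) {x y : V} (hx : x ∈ avoiding G X Z)
    (hy : y ∈ Y) (hxy : G.Adj x y) (hm : ∀ c ∈ mixed G X Y Z, G.Share x c → G.Adj c y) :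
    G.metricLine x y = Set.univ := by
  rw [Set.eq_univ_iff_forall]
  intro c
  rcases h.cover c with hc | hc | hc
  · rcases mem_cases (G := G) (Y := Y) (Z := Z) hc with hc | hc | hc
    · rw [h.lineAY_adj_mem_mixed hx hy hxy hc]
      have := hm c hc
      tauto
    · exact h.lineAY_adj_mem_avoiding_Z hx hy hxy hc
    · exact h.lineAY_adj_mem_avoiding_Y hx hy hxy hc
  · exact h.lineAY_adj_mem_Y hx hy hxy hc
  · exact h.lineAY_adj_mem_Z hx hy hxy hc

/-- If `y` were the only neighbour of `x`, every vertex sharing a neighbour with `x` would be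
adjacent to `y`, and the line of `x` and `y` would be universal. -/
theorem exists_other_adj (h : G.IsBisplitWith X Y Z)
    (hU : ∀ a b, a ≠ b → G.metricLine a b ≠ Set.univ) {x y : V} (hx : x ∈ avoiding G X Z)
    (hy : y ∈ Y) (hxy : G.Adj x y) : ∃ w ∈ Y, w ≠ y ∧ G.Adj x w := by
  by_contra! hcon
  refine hU x y (h.ne_of_mem_XY hx.1 hy) (h.lineAY_adj_eq_univ hx hy hxy ?_)
  rintro c hc ⟨w, h1, h2⟩
  by_cases e : w = y
  · rwa [← e]
  · exact absurd h1 (hcon w (h.mem_Y_of_adj_avoiding hx h1) e)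

/-- Fix `z₀` in `Z` and a `y₀` that, if the class is nonempty, has a neighbour in it. A vertex
adjacent to `y₀`, or to all of `Y` but `y₀`, is joined to `z₀`; any other vertex is joined to `y₀`,
which is then at distance 3. Lines of the first kind contain `Y`, those of the second do not. -/
theorem exists_family_avoiding [Finite V] (h : G.IsBisplitWith X Y Z)
    (hU : ∀ a b, a ≠ b → G.metricLine a b ≠ Set.univ) :
    ∃ y₀ ∈ Y, ∃ 𝓐 ⊆ G.metricLines, (avoiding G X Z).ncard ≤ 𝓐.ncard ∧
      ∀ L ∈ 𝓐, AvoidingSig G X Y Z y₀ L := by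
  classical
  obtain ⟨y₀, hy₀, hadj₀⟩ : ∃ y₀ ∈ Y, ∀ x ∈ avoiding G X Z, ∃ x₁ ∈ avoiding G X Z,
      G.Adj x₁ y₀ := by
    rcases (avoiding G X Z).eq_empty_or_nonempty with h0 | ⟨x, hx⟩
    · obtain ⟨y, hy⟩ := h.neY
      exact ⟨y, hy, by simp [h0]⟩
    · obtain ⟨y, hy, ha⟩ := h.exists_adj_of_avoiding hx
      exact ⟨y, hy, fun _ _ => ⟨x, hx, ha⟩⟩
  obtain ⟨z₀, hz₀⟩ := h.neZ
  refine ⟨y₀, hy₀, ?_⟩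
  have htwo : ∀ x ∈ avoiding G X Z, ∀ u, ∃ w ∈ Y, w ≠ u ∧ G.Adj x w := by
    intro x hx u
    obtain ⟨y, hy, hxy⟩ := h.exists_adj_of_avoiding hx
    by_cases e : y = u
    · subst e
      exact h.exists_other_adj hU hx hy hxy
    · exact ⟨y, hy, e, hxy⟩
  apply exists_family (R := fun x L =>
    ((G.Adj x y₀ ∨ ∀ y ∈ Y, y ≠ y₀ → G.Adj x y) ∧ L = G.metricLine x z₀) ∨
    (¬ (G.Adj x y₀ ∨ ∀ y ∈ Y, y ≠ y₀ → G.Adj x y) ∧ L = G.metricLine x y₀))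
  · intro x hx
    by_cases hc : G.Adj x y₀ ∨ ∀ y ∈ Y, y ≠ y₀ → G.Adj x y
    · refine ⟨_, metricLine_mem_metricLines (h.swap.ne_of_mem_XY hx.1 hz₀), ?_, Or.inl ⟨hc, rfl⟩⟩
      refine ⟨⟨x, hx, left_mem_metricLine _ _⟩, ?_, z₀, hz₀, right_mem_metricLine _ _,
        Or.inl ⟨?_, ?_, ⟨x, hx, rfl⟩, ?_⟩⟩
      · intro u
        obtain ⟨w, hw, hne, -⟩ := htwo x hx u
        exact ⟨w, hw, h.lineAZ_mem_Y hx hz₀ hw, hne⟩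
      · exact fun w hw => h.lineAZ_mem_Y hx hz₀ hw
      · exact fun z hz hL => (h.lineAZ_mem_Z hx hz₀ hz).1 hL
      -- Equality would force `Z = {z₀}`. If `x` is adjacent to `y₀`, every mixed vertex sharing a
      -- neighbour with `x` is then adjacent to `y₀`, so the line of `x` and `y₀` is universal.
      -- Otherwise a class member `x₁` adjacent to `y₀` also shares a neighbour with `x`, hence lies
      -- on the line of `y₀` and `z` but not on that of `x` and `z₀`.
      · intro z hz e
        by_cases ha : G.Adj x y₀
        · refine hU x y₀ (h.ne_of_mem_XY hx.1 hy₀) (h.lineAY_adj_eq_univ hx hy₀ ha ?_)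
          intro c hc hs
          have h1 := h.lineAZ_notMem_mixed hx hz₀ hc hs
          rw [← e, h.lineYZ_mem_mixed hy₀ hz hc] at h1
          obtain ⟨w, hw, hcw⟩ := hc.2.2
          have e1 : w = z₀ := by
            rw [← h.lineAZ_mem_Z hx hz₀ hw, ← e]
            exact h.lineYZ_mem_Z hy₀ hz hw
          have e2 : z = z₀ := by
            rw [← h.lineAZ_mem_Z hx hz₀ hz, ← e]
            exact right_mem_metricLine _ _
          rw [e1, ← e2] at hcw
          tauto
        · obtain ⟨x₁, hx₁, ha₁⟩ := hadj₀ x hx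
          obtain ⟨w, hw, hne, hxw⟩ := htwo x₁ hx₁ y₀
          have hxx : x ≠ x₁ := by
            rintro rfl
            exact ha ha₁
          apply h.lineAZ_notMem_of_share hx hz₀ hx₁ hxx ⟨w, (hc.resolve_left ha) w hw hne, hxw⟩
          rw [← e]
          exact h.lineYZ_mem_avoiding_Z hy₀ hz hx₁
    · refine ⟨_, metricLine_mem_metricLines (h.ne_of_mem_XY hx.1 hy₀), ?_, Or.inr ⟨hc, rfl⟩⟩
      push Not at hc
      obtain ⟨hn, y₁, hy₁, hne₁, hn₁⟩ := hc
      refine ⟨⟨x, hx, left_mem_metricLine _ _⟩, ?_, z₀, hz₀, h.lineAY_mem_Z hx hy₀ hn hz₀,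
        Or.inr ⟨?_, fun z hz => h.lineAY_mem_Z hx hy₀ hn hz, ?_,
          fun c hc => h.lineAY_notMem_avoiding_Y hx hy₀ hn hc⟩⟩
      · intro u
        obtain ⟨w, hw, hne, ha⟩ := htwo x hx u
        exact ⟨w, hw, (h.lineAY_mem_Y hx hy₀ hn hw).2 (Or.inl ha), hne⟩
      · intro hsub
        rcases (h.lineAY_mem_Y hx hy₀ hn hy₁).1 (hsub hy₁) with e | e
        · exact hn₁ e
        · exact hne₁ e
      · intro u v
        -- The trace on `Y` consists of `y₀` and at least two neighbours of `x`, so two vertices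
        -- never exhaust it. This keeps the line apart from `PairSig`.
        by_cases hu : u = y₀ ∨ v = y₀
        · obtain ⟨w, hw, hne, ha⟩ := htwo x hx (if u = y₀ then v else u)
          have hwy : w ≠ y₀ := by
            rintro rfl
            exact hn ha
          refine ⟨w, hw, (h.lineAY_mem_Y hx hy₀ hn hw).2 (Or.inl ha), ?_, ?_⟩ <;>
          · rcases hu with rfl | rfl <;> grind
        · push Not at hu
          exact ⟨y₀, hy₀, right_mem_metricLine _ _, hu.1.symm, hu.2.symm⟩
  · intro x hx x' hx' L h1 h2
    by_contra hne
    rcases h1 with ⟨c1, e1⟩ | ⟨c1, e1⟩ <;> rcases h2 with ⟨c2, e2⟩ | ⟨c2, e2⟩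
    -- Two vertices of the first kind share a neighbour: both see `y₀`, or one sees all of `Y`
    -- except `y₀` and the other has a neighbour there.
    · have hs : G.Share x x' := by
        obtain ⟨w, hw, hwne, hwa⟩ := htwo x hx y₀
        obtain ⟨w', hw', hwne', hwa'⟩ := htwo x' hx' y₀
        rcases c1 with c1 | c1
        · rcases c2 with c2 | c2
          · exact ⟨y₀, c1, c2⟩
          · exact ⟨w, hwa, c2 w hw hwne⟩
        · exact ⟨w', c1 w' hw' hwne', hwa'⟩
      apply h.lineAZ_notMem_of_share hx hz₀ hx' hne hs
      rw [← e1, e2]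
      exact left_mem_metricLine _ _
    · push Not at c2
      obtain ⟨hn, y₁, hy₁, hne₁, hn₁⟩ := c2
      have := h.lineAZ_mem_Y hx hz₀ hy₁
      rw [← e1, e2, h.lineAY_mem_Y hx' hy₀ hn hy₁] at this
      tauto
    · push Not at c1
      obtain ⟨hn, y₁, hy₁, hne₁, hn₁⟩ := c1
      have := h.lineAZ_mem_Y hx' hz₀ hy₁
      rw [← e2, e1, h.lineAY_mem_Y hx hy₀ hn hy₁] at this
      tauto
    · push Not at c1 c2
      apply h.lineAY_notMem_avoiding_Z hx hy₀ c1.1 hx' hne c2.1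
      rw [← e1, e2]
      exact left_mem_metricLine _ _

/-- The trace on `Z` is the set of neighbours of `x` there. Two vertices giving the same line
therefore share a neighbour, which excludes each from the other's line. -/
theorem exists_family_partial [Finite V] (h : G.IsBisplitWith X Y Z) :
    ∃ 𝓐 ⊆ G.metricLines, {x ∈ mixed G X Y Z | ∃ y ∈ Y, ¬ G.Adj x y}.ncard ≤ 𝓐.ncard ∧
      ∀ L ∈ 𝓐, PartialSig G X Y Z L := by
  apply exists_family (R := fun x L => ∃ y ∈ Y, ¬ G.Adj x y ∧ L = G.metricLine x y)
  · rintro x ⟨hx, y, hy, hxy⟩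
    refine ⟨_, metricLine_mem_metricLines (h.ne_of_mem_XY hx.1 hy), ?_, y, hy, hxy, rfl⟩
    refine ⟨⟨y, hy, fun c hc => h.lineXY_mem_Y hx hy hxy hc⟩, ?_, ?_,
      fun c hc => h.lineXY_notMem_avoiding_Y hx hy hxy hc, ?_⟩
    · intro hsub
      obtain ⟨w, hw, hxw⟩ := hx.2.1
      have := (h.lineXY_mem_Y hx hy hxy hw).1 (hsub hw)
      rw [this] at hxw
      exact hxy hxw
    · obtain ⟨z, hz, hxz⟩ := hx.2.2
      exact ⟨z, hz, (h.lineXY_mem_Z hx hy hxy hz).2 hxz⟩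
    · intro c hc
      refine h.lineXY_notMem_of_share hx hy hxy hc.1 ?_ (h.share_fullTo hc hx.1).symm
      rintro rfl
      exact hxy (hc.2.1 y hy)
  · rintro x ⟨hx, -⟩ x' ⟨hx', -⟩ L ⟨y, hy, hxy, e⟩ ⟨y', hy', hxy', e'⟩
    by_contra hne
    obtain ⟨z, hz, hxz⟩ := hx.2.2
    have hzL : z ∈ L := by rw [e]; exact (h.lineXY_mem_Z hx hy hxy hz).2 hxz
    rw [e', h.lineXY_mem_Z hx' hy' hxy' hz] at hzL
    apply h.lineXY_notMem_of_share hx hy hxy hx'.1 hne ⟨z, hxz, hzL⟩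
    rw [← e, e']
    exact left_mem_metricLine _ _

/-- All vertices of this class share every vertex of `Y` as a neighbour, so no line chosen for one
contains another. -/
theorem exists_family_half [Finite V] (h : G.IsBisplitWith X Y Z) :
    ∃ 𝓐 ⊆ G.metricLines, {x ∈ mixed G X Y Z | (∀ y ∈ Y, G.Adj x y) ∧
      ∃ z ∈ Z, ¬ G.Adj x z}.ncard ≤ 𝓐.ncard ∧ ∀ L ∈ 𝓐, HalfSig G X Y Z L := by
  apply exists_family (R := fun x L => ∃ z ∈ Z, ¬ G.Adj x z ∧ L = G.metricLine x z)
  · rintro x ⟨hx, hY, z, hz, hxz⟩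
    have hx' := mixed_swap hx
    refine ⟨_, metricLine_mem_metricLines (h.swap.ne_of_mem_XY hx.1 hz), ?_, z, hz, hxz, rfl⟩
    refine ⟨fun y hy => (h.swap.lineXY_mem_Z hx' hz hxz hy).2 (hY y hy),
      ⟨z, hz, fun c hc => h.swap.lineXY_mem_Y hx' hz hxz hc⟩, ?_, 
      fun c hc => h.swap.lineXY_notMem_avoiding_Y hx' hz hxz hc, ?_⟩
    · intro hsub
      obtain ⟨w, hw, hxw⟩ := hx.2.2
      have := (h.swap.lineXY_mem_Y hx' hz hxz hw).1 (hsub hw)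
      rw [this] at hxw
      exact hxz hxw
    · intro c hc
      refine h.swap.lineXY_notMem_of_share hx' hz hxz hc.1 ?_ (h.share_fullTo hc hx.1).symm
      rintro rfl
      exact hxz (hc.2.2 z hz)
  · rintro x ⟨hx, hY, -⟩ x' ⟨hx', hY', -⟩ L ⟨z, hz, hxz, e⟩ ⟨z', hz', hxz', e'⟩
    by_contra hne
    obtain ⟨y, hy⟩ := h.neY
    apply h.swap.lineXY_notMem_of_share (mixed_swap hx) hz hxz hx'.1 hne ⟨y, hY y hy, hY' y hy⟩
    rw [← e, e']
    exact left_mem_metricLine _ _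

theorem linePair_fullTo (h : G.IsBisplitWith X Y Z) {x x' : V} (hx : x ∈ fullTo G X Y Z)
    (hx' : x' ∈ fullTo G X Y Z) (hne : x ≠ x') :
    Y ⊆ G.metricLine x x' ∧ Z ⊆ G.metricLine x x' ∧
      ∀ c ∈ X, c ∈ G.metricLine x x' ↔ c = x ∨ c = x' := by
  have m := h.fullTo_subset_mixed hx
  have m' := h.fullTo_subset_mixed hx'
  have hs := h.share_fullTo hx hx'.1
  exact ⟨fun y hy => (h.lineXX_mem_Y m m' hne hs hy).2 ⟨hx.2.1 y hy, hx'.2.1 y hy⟩,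
    fun z hz => (h.swap.lineXX_mem_Y (mixed_swap m) (mixed_swap m') hne hs hz).2
      ⟨hx.2.2 z hz, hx'.2.2 z hz⟩,
    fun c hc => h.lineXX_mem_X m m' hne hs hc⟩

theorem lineFullY (h : G.IsBisplitWith X Y Z) {x y : V} (hx : x ∈ fullTo G X Y Z) (hy : y ∈ Y) :
    Y ⊆ G.metricLine x y ∧ (∀ z ∈ Z, z ∉ G.metricLine x y) :=
  ⟨fun c hc => h.lineXY_adj_mem_Y (hx.2.1 y hy) hy hc (hx.2.1 c hc),
    fun c hc => h.lineXY_adj_notMem_Z (hx.2.1 y hy) hy hc (hx.2.2 c hc)⟩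

theorem fullTo_swap {x : V} (hx : x ∈ fullTo G X Y Z) : x ∈ fullTo G X Z Y :=
  ⟨hx.1, hx.2.2, hx.2.1⟩

/-- Three or more vertices use lines of pairs. With one or two vertices there are too few pairs: one
line towards `Y` is taken, and a line towards `Z` only when there are exactly two, which leaves the
latter free in the case of one vertex. -/
theorem exists_family_full [Finite V] (h : G.IsBisplitWith X Y Z) :
    ∃ 𝓐 ⊆ G.metricLines, (fullTo G X Y Z).ncard ≤ 𝓐.ncard ∧ ∀ L ∈ 𝓐, FullSig G X Y Z L := by
  obtain ⟨y, hy⟩ := h.neY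
  obtain ⟨z, hz⟩ := h.neZ
  rcases le_or_gt 3 (fullTo G X Y Z).ncard with h3 | h3
  · obtain ⟨A, hA, hcard, hP⟩ := exists_family_pairs (G := G) h3
      fun u hu v hv hne c hc => (h.linePair_fullTo hu hv hne).2.2 c hc.1
    refine ⟨A, hA, hcard, fun L hL => Or.inl ?_⟩
    obtain ⟨u, hu, v, hv, hne, rfl⟩ := hP L hL
    obtain ⟨e1, e2, e3⟩ := h.linePair_fullTo hu hv hne
    exact ⟨h3, e1, e2, u, hu, v, hv, hne, e3⟩
  · rcases (fullTo G X Y Z).eq_empty_or_nonempty with h0 | ⟨x, hx⟩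
    · exact ⟨∅, Set.empty_subset _, by simp [h0], by simp⟩
    have e1 := h.lineFullY hx hy
    have e2 := h.swap.lineFullY (fullTo_swap hx) hz
    have l1 := metricLine_mem_metricLines (G := G) (h.ne_of_mem_XY hx.1 hy)
    have l2 := metricLine_mem_metricLines (G := G) (h.swap.ne_of_mem_XY hx.1 hz)
    have s1 : FullSig G X Y Z (G.metricLine x y) :=
      Or.inr (Or.inl ⟨by omega, e1.1, e1.2, x, hx, left_mem_metricLine _ _⟩)
    rcases Nat.lt_or_ge (fullTo G X Y Z).ncard 2 with h2 | h2
    · exact ⟨{G.metricLine x y}, by simpa using l1, by rw [Set.ncard_singleton]; omega, by simpa using s1⟩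
    · have s2 : FullSig G X Y Z (G.metricLine x z) :=
        Or.inr (Or.inr ⟨by omega, e2.1, e2.2, x, hx, left_mem_metricLine _ _⟩)
      refine ⟨{G.metricLine x y, G.metricLine x z}, ?_, ?_, ?_⟩
      · rintro _ (rfl | rfl)
        exacts [l1, l2]
      · rw [Set.ncard_pair]
        · omega
        · intro e
          exact e1.2 z hz (e ▸ right_mem_metricLine _ _)
      · rintro _ (rfl | rfl)
        exacts [s1, s2]

theorem exists_family_X [Finite V] (h : G.IsBisplitWith X Y Z)
    (hU : ∀ a b, a ≠ b → G.metricLine a b ≠ Set.univ) :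
    ∃ y₀ ∈ Y, ∃ z₀ ∈ Z, ∃ 𝓐 ⊆ G.metricLines, X.ncard ≤ 𝓐.ncard ∧
      ∀ L ∈ 𝓐, XSig G X Y Z y₀ z₀ L := by
  have hsum : X.ncard ≤ (avoiding G X Z).ncard + (avoiding G X Y).ncard +
      {x ∈ mixed G X Y Z | ∃ y ∈ Y, ¬ G.Adj x y}.ncard +
      {x ∈ mixed G X Y Z | (∀ y ∈ Y, G.Adj x y) ∧ ∃ z ∈ Z, ¬ G.Adj x z}.ncard +
      (fullTo G X Y Z).ncard := by
    have hsub : X ⊆ avoiding G X Z ∪ avoiding G X Y ∪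
        {x ∈ mixed G X Y Z | ∃ y ∈ Y, ¬ G.Adj x y} ∪
        {x ∈ mixed G X Y Z | (∀ y ∈ Y, G.Adj x y) ∧ ∃ z ∈ Z, ¬ G.Adj x z} ∪ fullTo G X Y Z := by
      intro x hx
      by_cases h1 : ∀ y ∈ Y, G.Adj x y
      · by_cases h2 : ∀ z ∈ Z, G.Adj x z
        · exact Or.inr ⟨hx, h1, h2⟩
        · push Not at h2
          rcases mem_cases (G := G) (Y := Y) (Z := Z) hx with hc | hc | hc
          · exact Or.inl (Or.inr ⟨hc, h1, h2⟩)
          · exact Or.inl (Or.inl (Or.inl (Or.inl hc)))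
          · exact Or.inl (Or.inl (Or.inl (Or.inr hc)))
      · push Not at h1
        rcases mem_cases (G := G) (Y := Y) (Z := Z) hx with hc | hc | hc
        · exact Or.inl (Or.inl (Or.inr ⟨hc, h1⟩))
        · exact Or.inl (Or.inl (Or.inl (Or.inl hc)))
        · exact Or.inl (Or.inl (Or.inl (Or.inr hc)))
    refine (Set.ncard_le_ncard hsub).trans ((Set.ncard_union_le _ _).trans ?_)
    gcongr
    refine (Set.ncard_union_le _ _).trans ?_
    gcongr
    refine (Set.ncard_union_le _ _).trans ?_
    gcongr
    exact Set.ncard_union_le _ _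
  have two : ∀ {S L : Set V} {y : V}, (∀ u, ∃ w ∈ S, w ∈ L ∧ w ≠ u) →
      (∀ c ∈ S, c ∈ L → c = y) → False := fun h1 h2 => by
    obtain ⟨w, hw, hL, hne⟩ := h1 _
    exact hne (h2 w hw hL)
  obtain ⟨y₀, hy₀, famY⟩ := h.exists_family_avoiding hU
  obtain ⟨z₀, hz₀, famZ⟩ := h.swap.exists_family_avoiding hU
  refine ⟨y₀, hy₀, z₀, hz₀, ?_⟩
  have fam := exists_family_union (exists_family_union (exists_family_union (exists_family_union
    famY famZ ?_)
    h.exists_family_partial ?_) h.exists_family_half ?_) h.exists_family_full ?_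
  · obtain ⟨A, hA, hcard, hP⟩ := fam
    exact ⟨A, hA, hsum.trans hcard, hP⟩
  · rintro L ⟨⟨x, hx, hxL⟩, hY, z₀, hz₀, hz₀L, hc⟩ ⟨⟨x', hx', hxL'⟩, hZ, y₀, hy₀, hy₀L, hc'⟩
    rcases hc' with ⟨-, hc', -⟩ | ⟨-, -, -, hc'⟩
    · exact two hY hc'
    · exact hc' x hx hxL
  · rintro L (⟨⟨x, hx, hxL⟩, hY, z₀, hz₀, hz₀L, hc⟩ | ⟨⟨x, hx, hxL⟩, hY, z₀, hz₀, hz₀L, hc⟩)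
      ⟨⟨y, hy, hyL⟩, -, -, hav, -⟩
    · exact two hY fun c hc hcL => (hyL c hc).1 hcL
    · exact hav x hx hxL
  · rintro L ((⟨⟨x, hx, hxL⟩, hY, z₀, hz₀, hz₀L, hc⟩ | ⟨⟨x, hx, hxL⟩, hY, z₀, hz₀, hz₀L, hc⟩) |
      ⟨-, hnY, -⟩) ⟨hYL, ⟨z, hz, hzL⟩, -, hav, -⟩
    · exact hav x hx hxL
    · exact two hY fun c hc hcL => (hzL c hc).1 hcL
    · exact hnY hYL
  · have nf : ∀ x ∈ fullTo G X Y Z, x ∉ avoiding G X Z ∧ x ∉ avoiding G X Y := by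
      intro x hx
      obtain ⟨-, ⟨y, hy, ha⟩, ⟨z, hz, hb⟩⟩ := h.fullTo_subset_mixed hx
      exact ⟨fun hc => hc.2 z hz hb, fun hc => hc.2 y hy ha⟩
    rintro L (((⟨⟨x, hx, hxL⟩, hY, z₀, hz₀, hz₀L, hc⟩ | ⟨⟨x, hx, hxL⟩, hY, z₀, hz₀, hz₀L, hc⟩) |
      ⟨⟨y, hy, hyL⟩, hnY, ⟨z, hz, hzL⟩, -, hf⟩) | ⟨hYL, ⟨z, hz, hzL⟩, hnZ, hav, hf⟩)
      (⟨-, f1, f2, u, hu, v, hv, hne, f3⟩ | ⟨-, f1, f2, u, hu, huL⟩ | ⟨-, f1, f2, u, hu, huL⟩)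
    · rcases (f3 x hx.1).1 hxL with rfl | rfl
      · exact (nf _ hu).1 hx
      · exact (nf _ hv).1 hx
    · exact f2 _ hz₀ hz₀L
    · obtain ⟨w, hw, hwL, -⟩ := hY x
      exact f2 w hw hwL
    · rcases (f3 x hx.1).1 hxL with rfl | rfl
      · exact (nf _ hu).2 hx
      · exact (nf _ hv).2 hx
    · obtain ⟨w, hw, hwL, -⟩ := hY x
      exact f2 w hw hwL
    · exact f2 _ hz₀ hz₀L
    · exact hnY f1
    · exact hf u hu huL
    · exact hf u hu huL
    · exact hnZ f2
    · exact hf u hu huL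
    · exact hf u hu huL

end IsBisplitWith

/-! ### Signatures of lines charged to `Y ∪ Z`, and their separation from `XSig`. -/

theorem exists_family_list {P : Set V → Prop} (l : List (Set V)) (hl : l.Nodup)
    (hP : ∀ L ∈ l, L ∈ G.metricLines ∧ P L) :
    ∃ 𝓐 ⊆ G.metricLines, l.length ≤ 𝓐.ncard ∧ ∀ L ∈ 𝓐, P L := by
  classical
  refine ⟨(l.toFinset : Set (Set V)), ?_, ?_, ?_⟩
  · intro L hL
    exact (hP L (by simpa using hL)).1
  · rw [Set.ncard_coe_finset, List.toFinset_card_of_nodup hl]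
  · intro L hL
    exact (hP L (by simpa using hL)).2

theorem ne_of_mem_notMem {L M : Set V} {c : V} (h1 : c ∈ L) (h2 : c ∉ M) : L ≠ M := by
  rintro rfl
  exact h2 h1

/-- Signature of the lines generated by two vertices of `Y`, when `Y` has a third vertex. -/
def PairSig (G : SimpleGraph V) (X Y Z : Set V) (L : Set V) : Prop :=
  (∃ u ∈ Y, ∃ v ∈ Y, u ≠ v ∧ ∀ c ∈ Y, c ∈ L ↔ c = u ∨ c = v) ∧ ¬ Y ⊆ L ∧ Z ⊆ L ∧
    ∀ c ∈ avoiding G X Y, c ∉ L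

/-- Signature of lines containing `Y` and `Z` that are not generated by two vertices of `X`
adjacent to all of `Y` and `Z`. -/
def WideSig (G : SimpleGraph V) (X Y Z : Set V) (L : Set V) : Prop :=
  Y ⊆ L ∧ Z ⊆ L ∧ (3 ≤ (fullTo G X Y Z).ncard → ∀ x ∈ fullTo G X Y Z, ∀ x' ∈ fullTo G X Y Z,
    ¬ ∀ c ∈ X, c ∈ L ↔ c = x ∨ c = x')

theorem fullTo_comm : fullTo G X Z Y = fullTo G X Y Z := by
  ext x
  exact ⟨IsBisplitWith.fullTo_swap, IsBisplitWith.fullTo_swap⟩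

theorem WideSig.swap {L : Set V} (h : WideSig G X Y Z L) : WideSig G X Z Y L := by
  obtain ⟨h1, h2, h3⟩ := h
  refine ⟨h2, h1, ?_⟩
  rwa [fullTo_comm]

theorem wideSig_of_fullTo_subset {L : Set V} (hY : Y ⊆ L) (hZ : Z ⊆ L)
    (hf : fullTo G X Y Z ⊆ L) : WideSig G X Y Z L := by
  refine ⟨hY, hZ, fun h3 x hx x' hx' hc => ?_⟩
  have hsub : fullTo G X Y Z ⊆ {x, x'} := fun c hcf => (hc c hcf.1).1 (hf hcf)
  have h1 := Set.ncard_le_ncard hsub (Set.toFinite _)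
  have h2 := Set.ncard_insert_le x {x'}
  rw [Set.ncard_singleton] at h2
  omega

theorem wideSig_of_notMem {L : Set V} (hY : Y ⊆ L) (hZ : Z ⊆ L)
    (hf : ∀ c ∈ fullTo G X Y Z, c ∉ L) : WideSig G X Y Z L :=
  ⟨hY, hZ, fun _ x hx _ _ hc => hf x hx ((hc x hx.1).2 (Or.inl rfl))⟩

theorem wideSig_of_mem {L : Set V} (hY : Y ⊆ L) (hZ : Z ⊆ L) {c : V} (hcX : c ∈ X)
    (hcf : c ∉ fullTo G X Y Z) (hcL : c ∈ L) : WideSig G X Y Z L := by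
  refine ⟨hY, hZ, fun _ x hx x' hx' hc => ?_⟩
  rcases (hc c hcX).1 hcL with rfl | rfl
  · exact hcf hx
  · exact hcf hx'

theorem PairSig.not_XSig {y₀ z₀ : V} {L : Set V} (h : PairSig G X Y Z L) :
    ¬ XSig G X Y Z y₀ z₀ L := by
  obtain ⟨⟨u, hu, v, hv, hne, htr⟩, hY, hZ, hav⟩ := h
  have huL := (htr u hu).2 (Or.inl rfl)
  have hvL := (htr v hv).2 (Or.inr rfl)
  rintro ((((⟨-, -, z, hz, -, (⟨f, -⟩ | ⟨-, -, f, -⟩)⟩ | ⟨⟨x, hx, hxL⟩, -⟩) |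
      ⟨⟨y, hy, hyL⟩, -⟩) | ⟨f, -⟩) | (⟨-, f, -⟩ | ⟨-, f, -⟩ | ⟨-, -, f, -⟩))
  · exact hY f
  · obtain ⟨w, hw, hwL, h1, h2⟩ := f u v
    rcases (htr w hw).1 hwL with e | e
    · exact h1 e
    · exact h2 e
  · exact hav x hx hxL
  · exact hne (((hyL u hu).1 huL).trans ((hyL v hv).1 hvL).symm)
  · exact hY f
  · exact hY f
  · exact hY f
  · exact f u hu huL

theorem PairSig.not_XSig_swap {y₀ z₀ : V} {L : Set V} (h : PairSig G X Z Y L) :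
    ¬ XSig G X Y Z y₀ z₀ L := by
  obtain ⟨⟨u, hu, v, hv, hne, htr⟩, hZ, hY, hav⟩ := h
  have huL := (htr u hu).2 (Or.inl rfl)
  have hvL := (htr v hv).2 (Or.inr rfl)
  rintro ((((⟨⟨x, hx, hxL⟩, -⟩ | ⟨-, -, z, hz, -, (⟨f, -⟩ | ⟨-, -, f, -⟩)⟩) |
      ⟨-, f, -⟩) | ⟨-, ⟨z, hz, hzL⟩, -⟩) | (⟨-, -, f, -⟩ | ⟨-, -, f, -⟩ | ⟨-, f, -⟩))
  · exact hav x hx hxL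
  · exact hZ f
  · obtain ⟨w, hw, hwL, h1, h2⟩ := f u v
    rcases (htr w hw).1 hwL with e | e
    · exact h1 e
    · exact h2 e
  · exact f hY
  · exact hne (((hzL u hu).1 huL).trans ((hzL v hv).1 hvL).symm)
  · exact hZ f
  · exact f u hu huL
  · exact hZ f

/-- A line containing `Y ∪ Z` can clash with a line chosen for a vertex seeing only one part just
when the opposite part is a single vertex. The two hypotheses dispose of these clashes, in a form
depending on the sizes. -/
theorem WideSig.not_XSig {y₀ z₀ : V} {L : Set V} (h : WideSig G X Y Z L)
    (h1 : ∀ x ∈ avoiding G X Z, ∀ z ∈ Z, (∀ w ∈ Z, w = z) → L = G.metricLine x z →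
      (∀ w ∈ Z, G.metricLine y₀ w ≠ L) → False)
    (h2 : ∀ x ∈ avoiding G X Y, ∀ u, ∃ w ∈ Y, w ≠ u) (hY0 : Y.Nonempty) (hZ0 : Z.Nonempty) :
    ¬ XSig G X Y Z y₀ z₀ L := by
  obtain ⟨hY, hZ, h3⟩ := h
  obtain ⟨y, hy⟩ := hY0
  obtain ⟨z, hz⟩ := hZ0
  rintro ((((⟨-, -, z, hz, -, (⟨-, f1, ⟨x, hx, f2⟩, f3⟩ | ⟨f, -⟩)⟩ |
    ⟨⟨x, hx, hxL⟩, -, y, hy, -, (⟨-, f1, -⟩ | ⟨f, -⟩)⟩) |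
      ⟨-, f, -⟩) | ⟨-, -, f, -⟩) | (⟨f1, -, -, x, hx, x', hx', -, f2⟩ | ⟨-, -, f, -⟩ | ⟨-, -, f, -⟩))
  · exact h1 x hx z hz (fun w hw => f1 w hw (hZ hw)) f2 f3
  · exact f hY
  · obtain ⟨w, hw, hne⟩ := h2 x hx y
    exact hne (f1 w hw (hY hw))
  · exact f hZ
  · exact f hY
  · exact f hZ
  · exact h3 f1 x hx x' hx' f2
  · exact f z hz (hZ hz)
  · exact f y hy (hY hy)

namespace IsBisplitWith

theorem exists_family_YY [Finite V] (h : G.IsBisplitWith X Y Z) (h3 : 3 ≤ Y.ncard) :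
    ∃ 𝓐 ⊆ G.metricLines, Y.ncard ≤ 𝓐.ncard ∧ ∀ L ∈ 𝓐, PairSig G X Y Z L := by
  obtain ⟨A, hA, hcard, hP⟩ := exists_family_pairs (G := G) h3
    fun u hu v hv hne c hc => h.lineYY_mem_Y hu hv hne hc
  refine ⟨A, hA, hcard, fun L hL => ?_⟩
  obtain ⟨u, hu, v, hv, hne, rfl⟩ := hP L hL
  refine ⟨⟨u, hu, v, hv, hne, fun c hc => h.lineYY_mem_Y hu hv hne hc⟩, ?_,
    fun z hz => h.lineYY_mem_Z hu hv hne hz, fun c hc => h.lineYY_notMem_avoiding_Y hu hv hne hc⟩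
  intro hsub
  have hs : Y ⊆ {u, v} := fun c hc => (h.lineYY_mem_Y hu hv hne hc).1 (hsub hc)
  have h1 := Set.ncard_le_ncard hs (Set.toFinite _)
  rw [Set.ncard_pair hne] at h1
  omega

theorem wideSig_lineYZ (h : G.IsBisplitWith X Y Z) {y z : V} (hy : y ∈ Y) (hz : z ∈ Z) :
    WideSig G X Y Z (G.metricLine y z) := by
  refine wideSig_of_notMem (fun c hc => h.lineYZ_mem_Y hy hz hc)
    (fun c hc => h.lineYZ_mem_Z hy hz hc) fun c hc => ?_
  rw [h.lineYZ_mem_mixed hy hz (h.fullTo_subset_mixed hc)]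
  simp [hc.2.1 y hy, hc.2.2 z hz]

theorem wideSig_lineYY (h : G.IsBisplitWith X Y Z) {y₁ y₂ : V} (hy₁ : y₁ ∈ Y) (hy₂ : y₂ ∈ Y)
    (hne : y₁ ≠ y₂) (hY : ∀ y ∈ Y, y = y₁ ∨ y = y₂) : WideSig G X Y Z (G.metricLine y₁ y₂) := by
  refine wideSig_of_fullTo_subset (fun c hc => (h.lineYY_mem_Y hy₁ hy₂ hne hc).2 (hY c hc))
    (fun c hc => h.lineYY_mem_Z hy₁ hy₂ hne hc) fun c hc => ?_
  exact (h.lineYY_mem_mixed hy₁ hy₂ hne (h.fullTo_subset_mixed hc)).2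
    ⟨hc.2.1 _ hy₁, hc.2.1 _ hy₂⟩

theorem wideSig_lineAY (h : G.IsBisplitWith X Y Z) {x y : V} (hx : x ∈ avoiding G X Z)
    (hy : y ∈ Y) (hxy : G.Adj x y) : WideSig G X Y Z (G.metricLine x y) := by
  refine wideSig_of_mem (fun c hc => h.lineAY_adj_mem_Y hx hy hxy hc)
    (fun c hc => h.lineAY_adj_mem_Z hx hy hxy hc) hx.1 (fun hf => ?_) (left_mem_metricLine _ _)
  obtain ⟨z, hz⟩ := h.neZ
  exact hx.2 z hz (hf.2.2 z hz)

theorem adj_all_of_avoiding (h : G.IsBisplitWith X Y Z)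
    (hU : ∀ a b, a ≠ b → G.metricLine a b ≠ Set.univ) {y₁ y₂ : V}
    (hY : ∀ y ∈ Y, y = y₁ ∨ y = y₂) {x : V} (hx : x ∈ avoiding G X Z) :
    G.Adj x y₁ ∧ G.Adj x y₂ := by
  obtain ⟨y, hy, ha⟩ := h.exists_adj_of_avoiding hx
  obtain ⟨w, hw, hne, hb⟩ := h.exists_other_adj hU hx hy ha
  rcases hY y hy with rfl | rfl <;> rcases hY w hw with rfl | rfl <;> first | contradiction | tauto

theorem avoiding_eq_empty (h : G.IsBisplitWith X Y Z)
    (hU : ∀ a b, a ≠ b → G.metricLine a b ≠ Set.univ) {y : V} (hY : ∀ w ∈ Y, w = y) {x : V} :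
    x ∉ avoiding G X Z := by
  intro hx
  obtain ⟨w, hw, ha⟩ := h.exists_adj_of_avoiding hx
  obtain ⟨w', hw', hne, -⟩ := h.exists_other_adj hU hx hw ha
  exact hne ((hY w' hw').trans (hY w hw).symm)

/-- All vertices that are not mixed lie on the line, so a missing vertex is mixed. The same holds
for the next two lemmas, and these missing vertices later tell lines apart. -/
theorem exists_notMem_lineYZ (h : G.IsBisplitWith X Y Z)
    (hU : ∀ a b, a ≠ b → G.metricLine a b ≠ Set.univ) {y z : V} (hy : y ∈ Y) (hz : z ∈ Z) :
    ∃ c ∈ mixed G X Y Z, (G.Adj c y ↔ G.Adj c z) := by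
  by_contra! hcon
  apply hU y z (h.ne_of_mem_YZ hy hz)
  rw [Set.eq_univ_iff_forall]
  intro c
  rcases h.cover c with hc | hc | hc
  · rcases mem_cases (G := G) (Y := Y) (Z := Z) hc with hc | hc | hc
    · rw [h.lineYZ_mem_mixed hy hz hc]
      have := hcon c hc
      tauto
    · exact h.lineYZ_mem_avoiding_Z hy hz hc
    · exact h.lineYZ_mem_avoiding_Y hy hz hc
  · exact h.lineYZ_mem_Y hy hz hc
  · exact h.lineYZ_mem_Z hy hz hc

theorem exists_notMem_lineYY (h : G.IsBisplitWith X Y Z)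
    (hU : ∀ a b, a ≠ b → G.metricLine a b ≠ Set.univ) {y₁ y₂ : V} (hy₁ : y₁ ∈ Y) (hy₂ : y₂ ∈ Y)
    (hne : y₁ ≠ y₂) (hY : ∀ y ∈ Y, y = y₁ ∨ y = y₂) (hav : ∀ x, x ∉ avoiding G X Y) :
    ∃ c ∈ mixed G X Y Z, ¬ (G.Adj c y₁ ∧ G.Adj c y₂) := by
  by_contra! hcon
  apply hU y₁ y₂ hne
  rw [Set.eq_univ_iff_forall]
  intro c
  rcases h.cover c with hc | hc | hc
  · rcases mem_cases (G := G) (Y := Y) (Z := Z) hc with hc | hc | hc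
    · exact (h.lineYY_mem_mixed hy₁ hy₂ hne hc).2 (hcon c hc)
    · exact h.lineYY_mem_avoiding_Z hy₁ hy₂ hne (h.adj_all_of_avoiding hU hY hc)
    · exact absurd hc (hav c)
  · exact (h.lineYY_mem_Y hy₁ hy₂ hne hc).2 (hY c hc)
  · exact h.lineYY_mem_Z hy₁ hy₂ hne hc

theorem exists_notMem_lineAY (h : G.IsBisplitWith X Y Z)
    (hU : ∀ a b, a ≠ b → G.metricLine a b ≠ Set.univ) {x y : V} (hx : x ∈ avoiding G X Z)
    (hy : y ∈ Y) (hxy : G.Adj x y) : ∃ c ∈ mixed G X Y Z, G.Share x c ∧ ¬ G.Adj c y := by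
  by_contra! hcon
  exact hU x y (h.ne_of_mem_XY hx.1 hy) (h.lineAY_adj_eq_univ hx hy hxy hcon)

theorem lines_YZ (h : G.IsBisplitWith X Y Z) {y z : V} (hy : y ∈ Y) (hz : z ∈ Z) :
    G.metricLine y z ∈ G.metricLines :=
  metricLine_mem_metricLines (h.ne_of_mem_YZ hy hz)

theorem adj_of_mixed_pair {y₁ y₂ : V} (hY : ∀ y ∈ Y, y = y₁ ∨ y = y₂) {c : V}
    (hc : c ∈ mixed G X Y Z) : G.Adj c y₁ ∨ G.Adj c y₂ := by
  obtain ⟨y, hy, ha⟩ := hc.2.1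
  rcases hY y hy with rfl | rfl
  · exact Or.inl ha
  · exact Or.inr ha

/-! ### The part `Y` has at least three vertices -/

/-- A vertex of `X` without neighbours in `Z` is on the line of `y` and `z₁` but off that of `z₁`
and `z₂`. If there is none, a mixed vertex missing from the latter sees exactly one of `z₁`, `z₂`,
hence lies on one of the lines from `y` to `z₁` or `z₂`. -/
theorem exists_family_three_two [Finite V] (h : G.IsBisplitWith X Y Z)
    (hU : ∀ a b, a ≠ b → G.metricLine a b ≠ Set.univ) {z₁ z₂ : V} (hz₁ : z₁ ∈ Z) (hz₂ : z₂ ∈ Z)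
    (hne : z₁ ≠ z₂) (hZ : ∀ z ∈ Z, z = z₁ ∨ z = z₂) :
    ∃ 𝓐 ⊆ G.metricLines, 2 ≤ 𝓐.ncard ∧ ∀ L ∈ 𝓐, WideSig G X Y Z L := by
  obtain ⟨y, hy⟩ := h.neY
  have hC := (h.swap.wideSig_lineYY hz₁ hz₂ hne hZ).swap
  suffices hs : ∃ z ∈ Z, G.metricLine y z ≠ G.metricLine z₁ z₂ by
    obtain ⟨z, hz, hd⟩ := hs
    refine exists_family_list [G.metricLine y z, G.metricLine z₁ z₂] (by simpa using hd) ?_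
    intro L hL
    simp only [List.mem_cons, List.not_mem_nil, or_false] at hL
    rcases hL with rfl | rfl
    · exact ⟨h.lines_YZ hy hz, h.wideSig_lineYZ hy hz⟩
    · exact ⟨metricLine_mem_metricLines hne, hC⟩
  by_cases hav : ∃ x, x ∈ avoiding G X Z
  · obtain ⟨x, hx⟩ := hav
    exact ⟨z₁, hz₁, ne_of_mem_notMem (h.lineYZ_mem_avoiding_Z hy hz₁ hx)
      (h.swap.lineYY_notMem_avoiding_Y hz₁ hz₂ hne hx)⟩
  · push Not at hav
    obtain ⟨c, hc, hn⟩ := h.swap.exists_notMem_lineYY hU hz₁ hz₂ hne hZ hav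
    have hcm := mixed_swap hc
    have hcL : c ∉ G.metricLine z₁ z₂ := by
      rwa [h.swap.lineYY_mem_mixed hz₁ hz₂ hne hc]
    have hor := adj_of_mixed_pair hZ hc
    have e : c ∈ G.metricLine y z₁ ∨ c ∈ G.metricLine y z₂ := by
      rw [h.lineYZ_mem_mixed hy hz₁ hcm, h.lineYZ_mem_mixed hy hz₂ hcm]
      tauto
    rcases e with e | e
    · exact ⟨z₁, hz₁, ne_of_mem_notMem e hcL⟩
    · exact ⟨z₂, hz₂, ne_of_mem_notMem e hcL⟩

/-! ### Both `Y` and `Z` have two vertices -/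

/-- Mixed vertices `c₁`, seeing only `y₂` in `Y`, and `c₂`, seeing only `y₁`, separate the lines
`xy₁`, `xy₂` and `y₁y₂`; the vertex `x` separates these from `z₁z₂`. -/
theorem exists_family_two_two_of_avoiding (h : G.IsBisplitWith X Y Z)
    (hU : ∀ a b, a ≠ b → G.metricLine a b ≠ Set.univ) {y₁ y₂ z₁ z₂ : V} (hy₁ : y₁ ∈ Y)
    (hy₂ : y₂ ∈ Y) (hney : y₁ ≠ y₂) (hY : ∀ y ∈ Y, y = y₁ ∨ y = y₂) (hz₁ : z₁ ∈ Z) (hz₂ : z₂ ∈ Z)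
    (hne : z₁ ≠ z₂) (hZ : ∀ z ∈ Z, z = z₁ ∨ z = z₂) {x : V} (hx : x ∈ avoiding G X Z) :
    ∃ 𝓐 ⊆ G.metricLines, 4 ≤ 𝓐.ncard ∧ ∀ L ∈ 𝓐, WideSig G X Y Z L := by
  obtain ⟨a₁, a₂⟩ := h.adj_all_of_avoiding hU hY hx
  obtain ⟨c₁, hc₁, hs₁, hn₁⟩ := h.exists_notMem_lineAY hU hx hy₁ a₁
  obtain ⟨c₂, hc₂, hs₂, hn₂⟩ := h.exists_notMem_lineAY hU hx hy₂ a₂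
  have b₁ := (adj_of_mixed_pair hY hc₁).resolve_left hn₁
  have b₂ := (adj_of_mixed_pair hY hc₂).resolve_right hn₂
  have hxC := h.swap.lineYY_notMem_avoiding_Y hz₁ hz₂ hne hx
  have hxB := h.lineYY_mem_avoiding_Z hy₁ hy₂ hney ⟨a₁, a₂⟩
  have m11 : c₁ ∉ G.metricLine x y₁ := by
    rw [h.lineAY_adj_mem_mixed hx hy₁ a₁ hc₁]; tauto
  have m12 : c₁ ∈ G.metricLine x y₂ := by
    rw [h.lineAY_adj_mem_mixed hx hy₂ a₂ hc₁]; tauto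
  have m21 : c₂ ∈ G.metricLine x y₁ := by
    rw [h.lineAY_adj_mem_mixed hx hy₁ a₁ hc₂]; tauto
  have mB1 : c₁ ∉ G.metricLine y₁ y₂ := by
    rw [h.lineYY_mem_mixed hy₁ hy₂ hney hc₁]; tauto
  have mB2 : c₂ ∉ G.metricLine y₁ y₂ := by
    rw [h.lineYY_mem_mixed hy₁ hy₂ hney hc₂]; tauto
  refine exists_family_list
    [G.metricLine x y₁, G.metricLine x y₂, G.metricLine y₁ y₂, G.metricLine z₁ z₂] ?_ ?_
  · simp only [List.nodup_cons, List.mem_cons, List.not_mem_nil, or_false, not_or, not_false_eq_true,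
      List.nodup_nil, and_true]
    exact ⟨⟨(ne_of_mem_notMem m12 m11).symm, ne_of_mem_notMem m21 mB2,
      ne_of_mem_notMem (left_mem_metricLine _ _) hxC⟩, ⟨ne_of_mem_notMem m12 mB1,
      ne_of_mem_notMem (left_mem_metricLine _ _) hxC⟩, ne_of_mem_notMem hxB hxC⟩
  · intro L hL
    simp only [List.mem_cons, List.not_mem_nil, or_false] at hL
    rcases hL with rfl | rfl | rfl | rfl
    · exact ⟨metricLine_mem_metricLines (h.ne_of_mem_XY hx.1 hy₁), h.wideSig_lineAY hx hy₁ a₁⟩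
    · exact ⟨metricLine_mem_metricLines (h.ne_of_mem_XY hx.1 hy₂), h.wideSig_lineAY hx hy₂ a₂⟩
    · exact ⟨metricLine_mem_metricLines hney, h.wideSig_lineYY hy₁ hy₂ hney hY⟩
    · exact ⟨metricLine_mem_metricLines hne, (h.swap.wideSig_lineYY hz₁ hz₂ hne hZ).swap⟩

/-- The four lines between `Y` and `Z` differ: `r` lies on those through just one of `y₁`, `y₂`,
while a mixed vertex seeing exactly one of `z₁`, `z₂` separates the two lines through a common `y`.
-/
theorem exists_family_two_two_of_half (h : G.IsBisplitWith X Y Z)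
    (hU : ∀ a b, a ≠ b → G.metricLine a b ≠ Set.univ) {y₁ y₂ z₁ z₂ : V} (hy₁ : y₁ ∈ Y)
    (hy₂ : y₂ ∈ Y) (hY : ∀ y ∈ Y, y = y₁ ∨ y = y₂) (hz₁ : z₁ ∈ Z) (hz₂ : z₂ ∈ Z)
    (hne : z₁ ≠ z₂) (hZ : ∀ z ∈ Z, z = z₁ ∨ z = z₂) (hav : ∀ x, x ∉ avoiding G X Z) {r : V}
    (hr : r ∈ mixed G X Y Z) (hrz : G.Adj r z₁ ∧ G.Adj r z₂) (hry : ¬ (G.Adj r y₁ ∧ G.Adj r y₂)) :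
    ∃ 𝓐 ⊆ G.metricLines, 4 ≤ 𝓐.ncard ∧ ∀ L ∈ 𝓐, WideSig G X Y Z L := by
  obtain ⟨c, hc', hn⟩ := h.swap.exists_notMem_lineYY hU hz₁ hz₂ hne hZ hav
  have hc := mixed_swap hc'
  have ho := adj_of_mixed_pair hZ hc'
  have hro := adj_of_mixed_pair hY hr
  have key : ∀ {y y' z z'}, y ∈ Y → y' ∈ Y → z ∈ Z → z' ∈ Z → (G.Adj r y ↔ ¬ G.Adj r y') →
      G.Adj r z → G.Adj r z' → G.metricLine y z ≠ G.metricLine y' z' := by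
    intro y y' z z' hy hy' hz hz' h1 h2 h3 e
    have e1 := h.lineYZ_mem_mixed hy hz hr
    rw [e, h.lineYZ_mem_mixed hy' hz' hr] at e1
    tauto
  have key' : ∀ {y}, y ∈ Y → G.metricLine y z₁ ≠ G.metricLine y z₂ := by
    intro y hy e
    have e1 := h.lineYZ_mem_mixed hy hz₁ hc
    rw [e, h.lineYZ_mem_mixed hy hz₂ hc] at e1
    tauto
  have hyy : G.Adj r y₁ ↔ ¬ G.Adj r y₂ := by tauto
  refine exists_family_list
    [G.metricLine y₁ z₁, G.metricLine y₁ z₂, G.metricLine y₂ z₁, G.metricLine y₂ z₂] ?_ ?_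
  · simp only [List.nodup_cons, List.mem_cons, List.not_mem_nil, or_false, not_or, not_false_eq_true,
      List.nodup_nil, and_true]
    exact ⟨⟨key' hy₁, key hy₁ hy₂ hz₁ hz₁ hyy hrz.1 hrz.1, key hy₁ hy₂ hz₁ hz₂ hyy hrz.1 hrz.2⟩,
      ⟨key hy₁ hy₂ hz₂ hz₁ hyy hrz.2 hrz.1, key hy₁ hy₂ hz₂ hz₂ hyy hrz.2 hrz.2⟩, key' hy₂⟩
  · intro L hL
    simp only [List.mem_cons, List.not_mem_nil, or_false] at hL
    rcases hL with rfl | rfl | rfl | rfl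
    · exact ⟨h.lines_YZ hy₁ hz₁, h.wideSig_lineYZ hy₁ hz₁⟩
    · exact ⟨h.lines_YZ hy₁ hz₂, h.wideSig_lineYZ hy₁ hz₂⟩
    · exact ⟨h.lines_YZ hy₂ hz₁, h.wideSig_lineYZ hy₂ hz₁⟩
    · exact ⟨h.lines_YZ hy₂ hz₂, h.wideSig_lineYZ hy₂ hz₂⟩

/-- Each mixed vertex sees everything, or exactly one vertex of each part. A vertex of the second
type separates `y₁z₁` from `y₁z₂`; a vertex missing from one of these separates the other from
`y₁y₂`. -/
theorem exists_family_two_two_of_matched (h : G.IsBisplitWith X Y Z)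
    (hU : ∀ a b, a ≠ b → G.metricLine a b ≠ Set.univ) {y₁ y₂ z₁ z₂ : V} (hy₁ : y₁ ∈ Y)
    (hy₂ : y₂ ∈ Y) (hney : y₁ ≠ y₂) (hY : ∀ y ∈ Y, y = y₁ ∨ y = y₂) (hz₁ : z₁ ∈ Z) (hz₂ : z₂ ∈ Z)
    (hZ : ∀ z ∈ Z, z = z₁ ∨ z = z₂) (hav : ∀ x, x ∉ avoiding G X Y)
    (hm : ∀ c ∈ mixed G X Y Z, G.Adj c y₁ ∧ G.Adj c y₂ ↔ G.Adj c z₁ ∧ G.Adj c z₂) :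
    ∃ 𝓐 ⊆ G.metricLines, 3 ≤ 𝓐.ncard ∧ ∀ L ∈ 𝓐, WideSig G X Y Z L := by
  obtain ⟨c, hc, hn⟩ := h.exists_notMem_lineYY hU hy₁ hy₂ hney hY hav
  obtain ⟨d₁, hd₁, e₁⟩ := h.exists_notMem_lineYZ hU hy₁ hz₁
  obtain ⟨d₂, hd₂, e₂⟩ := h.exists_notMem_lineYZ hU hy₁ hz₂
  have oz : ∀ c ∈ mixed G X Y Z, G.Adj c z₁ ∨ G.Adj c z₂ :=
    fun c hc => adj_of_mixed_pair hZ (mixed_swap hc)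
  have oy : ∀ c ∈ mixed G X Y Z, G.Adj c y₁ ∨ G.Adj c y₂ :=
    fun c hc => adj_of_mixed_pair hY hc
  refine exists_family_list [G.metricLine y₁ z₁, G.metricLine y₁ z₂, G.metricLine y₁ y₂] ?_ ?_
  · simp only [List.nodup_cons, List.mem_cons, List.not_mem_nil, or_false, not_or, not_false_eq_true,
      List.nodup_nil, and_true]
    refine ⟨⟨fun e => ?_, fun e => ?_⟩, fun e => ?_⟩
    · have e1 := h.lineYZ_mem_mixed hy₁ hz₁ hc
      rw [e, h.lineYZ_mem_mixed hy₁ hz₂ hc] at e1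
      have := hm c hc
      have := oz c hc
      grind
    · have e1 := h.lineYZ_mem_mixed hy₁ hz₁ hd₂
      rw [e, h.lineYY_mem_mixed hy₁ hy₂ hney hd₂] at e1
      have := hm d₂ hd₂
      have := oz d₂ hd₂
      have := oy d₂ hd₂
      grind
    · have e1 := h.lineYZ_mem_mixed hy₁ hz₂ hd₁
      rw [e, h.lineYY_mem_mixed hy₁ hy₂ hney hd₁] at e1
      have := hm d₁ hd₁
      have := oz d₁ hd₁
      have := oy d₁ hd₁
      grind
  · intro L hL
    simp only [List.mem_cons, List.not_mem_nil, or_false] at hL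
    rcases hL with rfl | rfl | rfl
    · exact ⟨h.lines_YZ hy₁ hz₁, h.wideSig_lineYZ hy₁ hz₁⟩
    · exact ⟨h.lines_YZ hy₁ hz₂, h.wideSig_lineYZ hy₁ hz₂⟩
    · exact ⟨metricLine_mem_metricLines hney, h.wideSig_lineYY hy₁ hy₂ hney hY⟩


/-- The fourth line is generated by two mixed vertices sharing a neighbour, so it meets `Y` and `Z`
in their common neighbours. Given a vertex `t` complete to both parts, it is paired with a vertex
missing part of `Y`: the line contains `t`, meets `Y` and does not contain `Y`. -/
theorem exists_extra_line_of_matched (h : G.IsBisplitWith X Y Z)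
    (hU : ∀ a b, a ≠ b → G.metricLine a b ≠ Set.univ) {y₁ y₂ z₁ z₂ : V} (hy₁ : y₁ ∈ Y)
    (hy₂ : y₂ ∈ Y) (hney : y₁ ≠ y₂) (hY : ∀ y ∈ Y, y = y₁ ∨ y = y₂) (hz₁ : z₁ ∈ Z) (hz₂ : z₂ ∈ Z)
    (hZ : ∀ z ∈ Z, z = z₁ ∨ z = z₂) (hav : ∀ x, x ∉ avoiding G X Y)
    (hav' : ∀ x, x ∉ avoiding G X Z)
    (hm : ∀ c ∈ mixed G X Y Z, G.Adj c y₁ ∧ G.Adj c y₂ ↔ G.Adj c z₁ ∧ G.Adj c z₂) (y₀ z₀ : V) :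
    ∃ L ∈ G.metricLines, (¬ Y ⊆ L ∨ ¬ Z ⊆ L) ∧ ¬ XSig G X Y Z y₀ z₀ L := by
  have oz : ∀ c ∈ mixed G X Y Z, G.Adj c z₁ ∨ G.Adj c z₂ :=
    fun c hc => adj_of_mixed_pair hZ (mixed_swap hc)
  have oy : ∀ c ∈ mixed G X Y Z, G.Adj c y₁ ∨ G.Adj c y₂ :=
    fun c hc => adj_of_mixed_pair hY hc
  by_cases hf : ∃ t, t ∈ fullTo G X Y Z
  · obtain ⟨t, ht⟩ := hf
    have htm := h.fullTo_subset_mixed ht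
    obtain ⟨c, hc, hn⟩ := h.exists_notMem_lineYY hU hy₁ hy₂ hney hY hav
    have hne : t ≠ c := by
      rintro rfl
      exact hn ⟨ht.2.1 _ hy₁, ht.2.1 _ hy₂⟩
    have hs := h.share_fullTo ht hc.1
    have hLY : ∀ y ∈ Y, y ∈ G.metricLine t c ↔ G.Adj c y := by
      intro y hy
      rw [h.lineXX_mem_Y htm hc hne hs hy]
      simp [ht.2.1 y hy]
    have hLZ : ∀ z ∈ Z, z ∈ G.metricLine t c ↔ G.Adj c z := by
      intro z hz
      rw [h.swap.lineXX_mem_Y (mixed_swap htm) (mixed_swap hc) hne hs hz]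
      simp [ht.2.2 z hz]
    have hYL : ¬ Y ⊆ G.metricLine t c := fun hsub =>
      hn ⟨(hLY _ hy₁).1 (hsub hy₁), (hLY _ hy₂).1 (hsub hy₂)⟩
    refine ⟨_, metricLine_mem_metricLines hne, Or.inl hYL, ?_⟩
    rintro ((((⟨⟨x, hx, -⟩, -⟩ | ⟨⟨x, hx, -⟩, -⟩) | ⟨-, -, -, -, f⟩) | ⟨-, -, -, -, f⟩) |
      (⟨-, f, -⟩ | ⟨-, f, -⟩ | ⟨-, -, f, -⟩))
    · exact hav' x hx
    · exact hav x hx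
    · exact f t ht (left_mem_metricLine _ _)
    · exact f t ht (left_mem_metricLine _ _)
    · exact hYL f
    · exact hYL f
    · obtain ⟨y, hy, ha⟩ := hc.2.1
      exact f y hy ((hLY y hy).2 ha)
  · push Not at hf
    obtain ⟨d₁, hd₁, e₁⟩ := h.exists_notMem_lineYZ hU hy₁ hz₁
    obtain ⟨d₂, hd₂, e₂⟩ := h.exists_notMem_lineYZ hU hy₁ hz₂
    have hnf : ∀ c ∈ mixed G X Y Z, ¬ (G.Adj c y₁ ∧ G.Adj c y₂) ∧ ¬ (G.Adj c z₁ ∧ G.Adj c z₂) := by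
      intro c hc
      have h1 : ¬ (G.Adj c y₁ ∧ G.Adj c y₂) := by
        intro h1
        have h2 := (hm c hc).1 h1
        refine hf c ⟨hc.1, fun y hy => ?_, fun z hz => ?_⟩
        · rcases hY y hy with rfl | rfl
          exacts [h1.1, h1.2]
        · rcases hZ z hz with rfl | rfl
          exacts [h2.1, h2.2]
      exact ⟨h1, fun h2 => h1 ((hm c hc).2 h2)⟩
    obtain ⟨n1, n1'⟩ := hnf d₁ hd₁
    obtain ⟨n2, n2'⟩ := hnf d₂ hd₂
    have o1 := oz d₁ hd₁
    have o2 := oz d₂ hd₂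
    have p1 := oy d₁ hd₁
    have p2 := oy d₂ hd₂
    have hne : d₁ ≠ d₂ := by
      rintro rfl
      grind
    have hs : G.Share d₁ d₂ := by
      by_cases b1 : G.Adj d₁ y₁ <;> by_cases b2 : G.Adj d₂ y₁
      · exact ⟨y₁, b1, b2⟩
      · exact ⟨z₁, e₁.1 b1, o2.resolve_right fun e => b2 (e₂.2 e)⟩
      · exact ⟨z₂, o1.resolve_left fun e => b1 (e₁.2 e), e₂.1 b2⟩
      · exact ⟨y₂, p1.resolve_left b1, p2.resolve_left b2⟩
    have hLY : ∀ y ∈ Y, y ∈ G.metricLine d₁ d₂ ↔ G.Adj d₁ y ∧ G.Adj d₂ y :=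
      fun y hy => h.lineXX_mem_Y hd₁ hd₂ hne hs hy
    have hLZ : ∀ z ∈ Z, z ∈ G.metricLine d₁ d₂ ↔ G.Adj d₁ z ∧ G.Adj d₂ z :=
      fun z hz => h.swap.lineXX_mem_Y (mixed_swap hd₁) (mixed_swap hd₂) hne hs hz
    have hYL : ¬ Y ⊆ G.metricLine d₁ d₂ := fun hsub =>
      n1 ⟨((hLY _ hy₁).1 (hsub hy₁)).1, ((hLY _ hy₂).1 (hsub hy₂)).1⟩
    -- Each of `d₁`, `d₂` sees one vertex of each part: `d₁` sees indices that agree, `d₂` indices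
    -- that differ. They thus have a common neighbour in exactly one part, whereas `PartialSig`
    -- needs both traces nonempty.
    have hempty : (∀ y ∈ Y, y ∉ G.metricLine d₁ d₂) ∨ ∀ z ∈ Z, z ∉ G.metricLine d₁ d₂ := by
      by_cases b : G.Adj d₁ y₁ ↔ G.Adj d₂ y₁
      · right
        intro z hz
        rw [hLZ z hz]
        rcases hZ z hz with rfl | rfl <;> grind
      · left
        intro y hy
        rw [hLY y hy]
        rcases hY y hy with rfl | rfl <;> grind
    refine ⟨_, metricLine_mem_metricLines hne, Or.inl hYL, ?_⟩
    rintro ((((⟨⟨x, hx, -⟩, -⟩ | ⟨⟨x, hx, -⟩, -⟩) | ⟨⟨y, hy, f1⟩, -, ⟨z, hz, f2⟩, -⟩) | ⟨f, -⟩) |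
      (⟨-, f, -⟩ | ⟨-, f, -⟩ | ⟨-, -, -, x, hx, -⟩))
    · exact hav' x hx
    · exact hav x hx
    · rcases hempty with e | e
      · exact e y hy ((f1 y hy).2 rfl)
      · exact e z hz f2
    · exact hYL f
    · exact hYL f
    · exact hYL f
    · exact hf x hx

theorem exists_family_two_two (h : G.IsBisplitWith X Y Z) [Finite V]
    (hU : ∀ a b, a ≠ b → G.metricLine a b ≠ Set.univ) {y₁ y₂ z₁ z₂ : V} (hy₁ : y₁ ∈ Y)
    (hy₂ : y₂ ∈ Y) (hney : y₁ ≠ y₂) (hY : ∀ y ∈ Y, y = y₁ ∨ y = y₂) (hz₁ : z₁ ∈ Z) (hz₂ : z₂ ∈ Z)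
    (hne : z₁ ≠ z₂) (hZ : ∀ z ∈ Z, z = z₁ ∨ z = z₂) (y₀ z₀ : V) :
    ∃ 𝓐 ⊆ G.metricLines, 4 ≤ 𝓐.ncard ∧ ∀ L ∈ 𝓐, ¬ XSig G X Y Z y₀ z₀ L := by
  have wide : ∀ L, WideSig G X Y Z L → ¬ XSig G X Y Z y₀ z₀ L := by
    intro L hL
    refine hL.not_XSig ?_ ?_ h.neY h.neZ
    · intro x hx z hz hall
      exact absurd ((hall z₁ hz₁).trans (hall z₂ hz₂).symm) hne
    · intro x hx u
      by_cases e : y₁ = u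
      · exact ⟨y₂, hy₂, fun e' => hney (e.trans e'.symm)⟩
      · exact ⟨y₁, hy₁, e⟩
  have fromWide : (∃ 𝓐 ⊆ G.metricLines, 4 ≤ 𝓐.ncard ∧ ∀ L ∈ 𝓐, WideSig G X Y Z L) →
      ∃ 𝓐 ⊆ G.metricLines, 4 ≤ 𝓐.ncard ∧ ∀ L ∈ 𝓐, ¬ XSig G X Y Z y₀ z₀ L := by
    rintro ⟨A, hA, hc, hP⟩
    exact ⟨A, hA, hc, fun L hL => wide L (hP L hL)⟩
  have fromWideSwap : (∃ 𝓐 ⊆ G.metricLines, 4 ≤ 𝓐.ncard ∧ ∀ L ∈ 𝓐, WideSig G X Z Y L) →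
      ∃ 𝓐 ⊆ G.metricLines, 4 ≤ 𝓐.ncard ∧ ∀ L ∈ 𝓐, ¬ XSig G X Y Z y₀ z₀ L := by
    rintro ⟨A, hA, hc, hP⟩
    exact ⟨A, hA, hc, fun L hL => wide L (hP L hL).swap⟩
  by_cases hav : ∃ x, x ∈ avoiding G X Z
  · obtain ⟨x, hx⟩ := hav
    exact fromWide (h.exists_family_two_two_of_avoiding hU hy₁ hy₂ hney hY hz₁ hz₂ hne hZ hx)
  by_cases hav' : ∃ x, x ∈ avoiding G X Y
  · obtain ⟨x, hx⟩ := hav'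
    exact fromWideSwap
      (h.swap.exists_family_two_two_of_avoiding hU hz₁ hz₂ hne hZ hy₁ hy₂ hney hY hx)
  push Not at hav hav'
  by_cases hR : ∃ r ∈ mixed G X Y Z, (G.Adj r z₁ ∧ G.Adj r z₂) ∧ ¬ (G.Adj r y₁ ∧ G.Adj r y₂)
  · obtain ⟨r, hr, r1, r2⟩ := hR
    exact fromWide (h.exists_family_two_two_of_half hU hy₁ hy₂ hY hz₁ hz₂ hne hZ hav hr r1 r2)
  by_cases hS : ∃ r ∈ mixed G X Y Z, (G.Adj r y₁ ∧ G.Adj r y₂) ∧ ¬ (G.Adj r z₁ ∧ G.Adj r z₂)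
  · obtain ⟨r, hr, r1, r2⟩ := hS
    exact fromWideSwap (h.swap.exists_family_two_two_of_half hU hz₁ hz₂ hZ hy₁ hy₂ hney hY hav'
      (mixed_swap hr) r1 r2)
  push Not at hR hS
  have hm : ∀ c ∈ mixed G X Y Z, G.Adj c y₁ ∧ G.Adj c y₂ ↔ G.Adj c z₁ ∧ G.Adj c z₂ := by
    intro c hc
    have h1 := hR c hc
    have h2 := hS c hc
    tauto
  obtain ⟨L, hL, hns, hX⟩ := h.exists_extra_line_of_matched hU hy₁ hy₂ hney hY hz₁ hz₂ hZ hav' hav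
    hm y₀ z₀
  have h1 := h.exists_family_two_two_of_matched hU hy₁ hy₂ hney hY hz₁ hz₂ hZ hav' hm
  have h2 := exists_family_list (G := G)
    (P := fun L => (¬ Y ⊆ L ∨ ¬ Z ⊆ L) ∧ ¬ XSig G X Y Z y₀ z₀ L) [L] (by simp)
    (by simpa using ⟨hL, hns, hX⟩)
  obtain ⟨A, hA, hc, hP⟩ := exists_family_union h1 h2 (by
    rintro M ⟨w1, w2, -⟩ ⟨w3 | w3, -⟩
    · exact w3 w1
    · exact w3 w2)
  exact ⟨A, hA, hc, fun M hM => (hP M hM).elim (wide M) fun e => e.2⟩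

/-! ### The part `Z` has one vertex -/

/-- With `Z = {z}`, every mixed vertex sees `z`. If some `x` sees only `Y`, the lines `xy₁`, `xy₂`
are joined by that of two mixed vertices with no common neighbour in `Y`, which misses `Y`.
Otherwise `y₁z`, `y₂z` and `y₁y₂` suffice. -/
theorem exists_family_two_one (h : G.IsBisplitWith X Y Z)
    (hU : ∀ a b, a ≠ b → G.metricLine a b ≠ Set.univ) {y₁ y₂ z : V} (hy₁ : y₁ ∈ Y)
    (hy₂ : y₂ ∈ Y) (hney : y₁ ≠ y₂) (hY : ∀ y ∈ Y, y = y₁ ∨ y = y₂) (hz : z ∈ Z)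
    (hZ : ∀ w ∈ Z, w = z) (y₀ z₀ : V) :
    ∃ 𝓐 ⊆ G.metricLines, 3 ≤ 𝓐.ncard ∧ ∀ L ∈ 𝓐, ¬ XSig G X Y Z y₀ z₀ L := by
  have hav' : ∀ x, x ∉ avoiding G X Y := fun x => h.swap.avoiding_eq_empty hU hZ
  have adjz : ∀ c ∈ mixed G X Y Z, G.Adj c z := by
    intro c hc
    obtain ⟨w, hw, ha⟩ := hc.2.2
    rwa [← hZ w hw]
  have oy : ∀ c ∈ mixed G X Y Z, G.Adj c y₁ ∨ G.Adj c y₂ :=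
    fun c hc => adj_of_mixed_pair hY hc
  -- A line from a vertex seeing only `Y` to `z` contains no mixed vertex, so one mixed vertex on a
  -- wide line rules out the clash.
  have wide : ∀ L, WideSig G X Y Z L → (∀ x ∈ avoiding G X Z, ∃ c ∈ mixed G X Y Z, c ∈ L) →
      ¬ XSig G X Y Z y₀ z₀ L := by
    intro L hL hc
    refine hL.not_XSig ?_ (fun x hx => absurd hx (hav' x)) h.neY h.neZ
    rintro x hx w hw - rfl -
    obtain ⟨c, hcm, hcL⟩ := hc x hx
    refine h.lineAZ_notMem_mixed hx hw hcm ?_ hcL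
    obtain ⟨a1, a2⟩ := h.adj_all_of_avoiding hU hY hx
    rcases oy c hcm with e | e
    · exact ⟨y₁, a1, e⟩
    · exact ⟨y₂, a2, e⟩
  by_cases hav : ∃ x, x ∈ avoiding G X Z
  · obtain ⟨x, hx⟩ := hav
    obtain ⟨a₁, a₂⟩ := h.adj_all_of_avoiding hU hY hx
    obtain ⟨c₁, hc₁, hs₁, hn₁⟩ := h.exists_notMem_lineAY hU hx hy₁ a₁
    obtain ⟨c₂, hc₂, hs₂, hn₂⟩ := h.exists_notMem_lineAY hU hx hy₂ a₂
    have b₁ := (oy c₁ hc₁).resolve_left hn₁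
    have b₂ := (oy c₂ hc₂).resolve_right hn₂
    have m11 : c₁ ∉ G.metricLine x y₁ := by
      rw [h.lineAY_adj_mem_mixed hx hy₁ a₁ hc₁]; tauto
    have m12 : c₁ ∈ G.metricLine x y₂ := by
      rw [h.lineAY_adj_mem_mixed hx hy₂ a₂ hc₁]; tauto
    have m21 : c₂ ∈ G.metricLine x y₁ := by
      rw [h.lineAY_adj_mem_mixed hx hy₁ a₁ hc₂]; tauto
    have hne : c₁ ≠ c₂ := by
      rintro rfl
      exact hn₂ b₁
    have hs : G.Share c₁ c₂ := ⟨z, adjz _ hc₁, adjz _ hc₂⟩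
    have hD : ∀ y ∈ Y, y ∉ G.metricLine c₁ c₂ := by
      intro y hy
      rw [h.lineXX_mem_Y hc₁ hc₂ hne hs hy]
      rcases hY y hy with rfl | rfl <;> tauto
    have hDX : ¬ XSig G X Y Z y₀ z₀ (G.metricLine c₁ c₂) := by
      rintro ((((⟨-, f, -⟩ | ⟨⟨x, hx, -⟩, -⟩) | ⟨⟨y, hy, f⟩, -⟩) | ⟨f, -⟩) |
        (⟨-, f, -⟩ | ⟨-, f, -⟩ | ⟨-, -, -, t, ht, f⟩))
      · obtain ⟨w, hw, hwL, -⟩ := f z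
        exact hD w hw hwL
      · exact hav' x hx
      · exact hD y hy ((f y hy).2 rfl)
      · exact hD _ hy₁ (f hy₁)
      · exact hD _ hy₁ (f hy₁)
      · exact hD _ hy₁ (f hy₁)
      · rcases (h.lineXX_mem_X hc₁ hc₂ hne hs ht.1).1 f with rfl | rfl
        · exact hn₁ (ht.2.1 _ hy₁)
        · exact hn₂ (ht.2.1 _ hy₂)
    have w1 := h.wideSig_lineAY hx hy₁ a₁
    have w2 := h.wideSig_lineAY hx hy₂ a₂
    refine exists_family_list [G.metricLine x y₁, G.metricLine x y₂, G.metricLine c₁ c₂] ?_ ?_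
    · simp only [List.nodup_cons, List.mem_cons, List.not_mem_nil, or_false, not_or,
        not_false_eq_true, List.nodup_nil, and_true]
      exact ⟨⟨(ne_of_mem_notMem m12 m11).symm, ne_of_mem_notMem (w1.1 hy₁) (hD _ hy₁)⟩,
        ne_of_mem_notMem (w2.1 hy₁) (hD _ hy₁)⟩
    · intro L hL
      simp only [List.mem_cons, List.not_mem_nil, or_false] at hL
      rcases hL with rfl | rfl | rfl
      · exact ⟨metricLine_mem_metricLines (h.ne_of_mem_XY hx.1 hy₁),
          wide _ w1 fun _ _ => ⟨c₂, hc₂, m21⟩⟩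
      · exact ⟨metricLine_mem_metricLines (h.ne_of_mem_XY hx.1 hy₂),
          wide _ w2 fun _ _ => ⟨c₁, hc₁, m12⟩⟩
      · exact ⟨metricLine_mem_metricLines hne, hDX⟩
  · push Not at hav
    obtain ⟨c, hc, hn⟩ := h.exists_notMem_lineYY hU hy₁ hy₂ hney hY hav'
    obtain ⟨d₁, hd₁, e₁⟩ := h.exists_notMem_lineYZ hU hy₁ hz
    obtain ⟨d₂, hd₂, e₂⟩ := h.exists_notMem_lineYZ hU hy₂ hz
    have hA : ∀ y ∈ Y, ∀ c ∈ mixed G X Y Z, c ∈ G.metricLine y z ↔ ¬ G.Adj c y := by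
      intro y hy c hc
      rw [h.lineYZ_mem_mixed hy hz hc]
      simp [adjz c hc]
    have hB := fun c hc => h.lineYY_mem_mixed (c := c) hy₁ hy₂ hney hc
    have f1 := e₁.2 (adjz d₁ hd₁)
    have f2 := e₂.2 (adjz d₂ hd₂)
    refine exists_family_list [G.metricLine y₁ z, G.metricLine y₂ z, G.metricLine y₁ y₂] ?_ ?_
    · simp only [List.nodup_cons, List.mem_cons, List.not_mem_nil, or_false, not_or,
        not_false_eq_true, List.nodup_nil, and_true]
      refine ⟨⟨fun e => ?_, fun e => ?_⟩, fun e => ?_⟩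
      · have e1 := hA y₁ hy₁ c hc
        rw [e, hA y₂ hy₂ c hc] at e1
        have := oy c hc
        tauto
      · have e1 := hA y₁ hy₁ d₂ hd₂
        rw [e, hB d₂ hd₂] at e1
        tauto
      · have e1 := hA y₂ hy₂ d₁ hd₁
        rw [e, hB d₁ hd₁] at e1
        tauto
    · intro L hL
      simp only [List.mem_cons, List.not_mem_nil, or_false] at hL
      rcases hL with rfl | rfl | rfl
      · exact ⟨h.lines_YZ hy₁ hz, wide _ (h.wideSig_lineYZ hy₁ hz) fun x hx => absurd hx (hav x)⟩
      · exact ⟨h.lines_YZ hy₂ hz, wide _ (h.wideSig_lineYZ hy₂ hz) fun x hx => absurd hx (hav x)⟩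
      · exact ⟨metricLine_mem_metricLines hney,
          wide _ (h.wideSig_lineYY hy₁ hy₂ hney hY) fun x hx => absurd hx (hav x)⟩

/-- Every vertex of `X` sees both `y` and `z`. Their number is not 2, as the two would generate a
universal line. The line `yz` is supplemented by `ty` when there are at least three of them and by
`tz` when `t` is the only one: exactly the lines that `FullSig` leaves unused. -/
theorem exists_family_one_one [Finite V] (h : G.IsBisplitWith X Y Z)
    (hU : ∀ a b, a ≠ b → G.metricLine a b ≠ Set.univ) {y z : V} (hy : y ∈ Y)
    (hY : ∀ w ∈ Y, w = y) (hz : z ∈ Z) (hZ : ∀ w ∈ Z, w = z) (y₀ z₀ : V) :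
    ∃ 𝓐 ⊆ G.metricLines, 2 ≤ 𝓐.ncard ∧ ∀ L ∈ 𝓐, ¬ XSig G X Y Z y₀ z₀ L := by
  have hav : ∀ x, x ∉ avoiding G X Z := fun x => h.avoiding_eq_empty hU hY
  have hav' : ∀ x, x ∉ avoiding G X Y := fun x => h.swap.avoiding_eq_empty hU hZ
  have hmf : ∀ c ∈ mixed G X Y Z, c ∈ fullTo G X Y Z := by
    intro c hc
    obtain ⟨w, hw, ha⟩ := hc.2.1
    obtain ⟨v, hv, hb⟩ := hc.2.2
    refine ⟨hc.1, fun u hu => ?_, fun u hu => ?_⟩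
    · rwa [hY u hu, ← hY w hw]
    · rwa [hZ u hu, ← hZ v hv]
  have hXf : ∀ c ∈ X, c ∈ fullTo G X Y Z := by
    intro c hc
    rcases mem_cases (G := G) (Y := Y) (Z := Z) hc with hc | hc | hc
    · exact hmf c hc
    · exact absurd hc (hav c)
    · exact absurd hc (hav' c)
  obtain ⟨t, htm, -⟩ := h.exists_notMem_lineYZ hU hy hz
  have ht := hmf t htm
  have hA := h.wideSig_lineYZ hy hz
  have hAX : ¬ XSig G X Y Z y₀ z₀ (G.metricLine y z) :=
    hA.not_XSig (fun x hx => absurd hx (hav x)) (fun x hx => absurd hx (hav' x)) h.neY h.neZ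
  have h2 : (fullTo G X Y Z).ncard ≠ 2 := by
    intro e
    obtain ⟨u, v, hne, huv⟩ := Set.ncard_eq_two.1 e
    have hu : u ∈ fullTo G X Y Z := by rw [huv]; simp
    have hv : v ∈ fullTo G X Y Z := by rw [huv]; simp
    obtain ⟨p1, p2, p3⟩ := h.linePair_fullTo hu hv hne
    apply hU u v hne
    rw [Set.eq_univ_iff_forall]
    intro c
    rcases h.cover c with hc | hc | hc
    · rw [p3 c hc]
      have := hXf c hc
      rw [huv] at this
      simpa using this
    · exact p1 hc
    · exact p2 hc
  have finish : ∀ L ∈ G.metricLines, (¬ Y ⊆ L ∨ ¬ Z ⊆ L) → ¬ XSig G X Y Z y₀ z₀ L →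
      ∃ 𝓐 ⊆ G.metricLines, 2 ≤ 𝓐.ncard ∧ ∀ L ∈ 𝓐, ¬ XSig G X Y Z y₀ z₀ L := by
    intro L hL hn hX
    refine exists_family_list [G.metricLine y z, L] ?_ ?_
    · simp only [List.nodup_cons, List.mem_cons, List.not_mem_nil, or_false,
        not_false_eq_true, List.nodup_nil, and_true]
      rintro rfl
      rcases hn with hn | hn
      · exact hn hA.1
      · exact hn hA.2.1
    · intro M hM
      simp only [List.mem_cons, List.not_mem_nil, or_false] at hM
      rcases hM with rfl | rfl
      · exact ⟨h.lines_YZ hy hz, hAX⟩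
      · exact ⟨hL, hX⟩
  rcases le_or_gt 3 (fullTo G X Y Z).ncard with h3 | h3
  · obtain ⟨p1, p2⟩ := h.lineFullY ht hy
    refine finish _ (metricLine_mem_metricLines (h.ne_of_mem_XY ht.1 hy))
      (Or.inr fun hs => p2 z hz (hs hz)) ?_
    rintro ((((⟨⟨x, hx, -⟩, -⟩ | ⟨⟨x, hx, -⟩, -⟩) | ⟨-, -, -, -, f⟩) | ⟨-, -, -, -, f⟩) |
      (⟨-, -, f, -⟩ | ⟨f, -⟩ | ⟨f, -⟩))
    · exact hav x hx
    · exact hav' x hx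
    · exact f t ht (left_mem_metricLine _ _)
    · exact f t ht (left_mem_metricLine _ _)
    · exact p2 z hz (f hz)
    · omega
    · omega
  · obtain ⟨p1, p2⟩ := h.swap.lineFullY (fullTo_swap ht) hz
    refine finish _ (metricLine_mem_metricLines (h.swap.ne_of_mem_XY ht.1 hz))
      (Or.inl fun hs => p2 y hy (hs hy)) ?_
    rintro ((((⟨⟨x, hx, -⟩, -⟩ | ⟨⟨x, hx, -⟩, -⟩) | ⟨-, -, -, -, f⟩) | ⟨-, -, -, -, f⟩) |
      (⟨f, -⟩ | ⟨-, f, -⟩ | ⟨f, -⟩))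
    · exact hav x hx
    · exact hav' x hx
    · exact f t ht (left_mem_metricLine _ _)
    · exact f t ht (left_mem_metricLine _ _)
    · omega
    · exact p2 y hy (f hy)
    · omega

/-! ### Assembly by the sizes of `Y` and `Z`. -/

theorem exists_family_YZ [Finite V] (h : G.IsBisplitWith X Y Z)
    (hU : ∀ a b, a ≠ b → G.metricLine a b ≠ Set.univ) (hle : Z.ncard ≤ Y.ncard) {y₀ : V}
    (hy₀ : y₀ ∈ Y) (z₀ : V) :
    ∃ 𝓐 ⊆ G.metricLines, Y.ncard + Z.ncard ≤ 𝓐.ncard ∧ ∀ L ∈ 𝓐, ¬ XSig G X Y Z y₀ z₀ L := by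
  have hZ1 : 0 < Z.ncard := (Set.ncard_pos (Set.toFinite _)).2 h.neZ
  have pair : ∀ {S : Set V}, S.ncard = 2 → ∃ u ∈ S, ∃ v ∈ S, u ≠ v ∧ ∀ w ∈ S, w = u ∨ w = v := by
    intro S hS
    obtain ⟨u, v, hne, rfl⟩ := Set.ncard_eq_two.1 hS
    exact ⟨u, by simp, v, by simp, hne, by simp⟩
  have single : ∀ {S : Set V}, S.ncard = 1 → ∃ u ∈ S, ∀ w ∈ S, w = u := by
    intro S hS
    obtain ⟨u, rfl⟩ := Set.ncard_eq_one.1 hS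
    exact ⟨u, by simp, by simp⟩
  rcases le_or_gt 3 Y.ncard with hY3 | hY3
  · have other : ∀ u, ∃ w ∈ Y, w ≠ u := fun u =>
      Set.exists_ne_of_one_lt_ncard (by omega) u
    have famY := h.exists_family_YY hY3
    rcases le_or_gt 3 Z.ncard with hZ3 | hZ3
    · obtain ⟨A, hA, hc, hP⟩ := exists_family_union famY (h.swap.exists_family_YY hZ3)
        (fun L h1 h2 => h1.2.1 h2.2.2.1)
      exact ⟨A, hA, hc, fun L hL => (hP L hL).elim PairSig.not_XSig PairSig.not_XSig_swap⟩
    · have hZ' : Z.ncard = 2 ∨ Z.ncard = 1 := by omega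
      rcases hZ' with hZ2 | hZ2
      · obtain ⟨z₁, hz₁, z₂, hz₂, hne, hZ⟩ := pair hZ2
        obtain ⟨A, hA, hc, hP⟩ := exists_family_union famY
          (h.exists_family_three_two hU hz₁ hz₂ hne hZ) (fun L h1 h2 => h1.2.1 h2.1)
        refine ⟨A, hA, by omega, fun L hL => (hP L hL).elim PairSig.not_XSig fun hw => ?_⟩
        exact hw.not_XSig
          (fun x hx z hz hall => absurd ((hall z₁ hz₁).trans (hall z₂ hz₂).symm) hne)
          (fun _ _ => other) h.neY h.neZ
      · obtain ⟨z, hz, hZ⟩ := single hZ2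
        -- The generator in `Y` must be the `y₀` fixed in the choice for `X`: `AvoidingSig` excludes
        -- the lines of `y₀` with vertices of `Z`, precisely for this case.
        have famA : ∃ 𝓐 ⊆ G.metricLines, 1 ≤ 𝓐.ncard ∧
            ∀ L ∈ 𝓐, WideSig G X Y Z L ∧ L = G.metricLine y₀ z :=
          exists_family_list [G.metricLine y₀ z] (by simp)
            (by simpa using ⟨h.lines_YZ hy₀ hz, h.wideSig_lineYZ hy₀ hz⟩)
        obtain ⟨A, hA, hc, hP⟩ := exists_family_union famY famA (fun L h1 h2 => h1.2.1 h2.1.1)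
        refine ⟨A, hA, by omega, fun L hL => (hP L hL).elim PairSig.not_XSig fun hw => ?_⟩
        exact hw.1.not_XSig (fun x hx w hw' hall e f => f z hz hw.2.symm)
          (fun _ _ => other) h.neY h.neZ
  · have hcases : (Y.ncard = 2 ∧ Z.ncard = 2) ∨ (Y.ncard = 2 ∧ Z.ncard = 1) ∨
        (Y.ncard = 1 ∧ Z.ncard = 1) := by omega
    rcases hcases with ⟨e1, e2⟩ | ⟨e1, e2⟩ | ⟨e1, e2⟩ <;> rw [e1, e2]
    · obtain ⟨y₁, hy₁, y₂, hy₂, hney, hY⟩ := pair e1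
      obtain ⟨z₁, hz₁, z₂, hz₂, hne, hZ⟩ := pair e2
      exact h.exists_family_two_two hU hy₁ hy₂ hney hY hz₁ hz₂ hne hZ y₀ z₀
    · obtain ⟨y₁, hy₁, y₂, hy₂, hney, hY⟩ := pair e1
      obtain ⟨z, hz, hZ⟩ := single e2
      exact h.exists_family_two_one hU hy₁ hy₂ hney hY hz hZ y₀ z₀
    · obtain ⟨y, hy, hY⟩ := single e1
      obtain ⟨z, hz, hZ⟩ := single e2
      exact h.exists_family_one_one hU hy hY hz hZ y₀ z₀

theorem card_le_ncard_metricLines_of_le [Finite V] (h : G.IsBisplitWith X Y Z)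
    (hU : ∀ a b, a ≠ b → G.metricLine a b ≠ Set.univ) (hle : Z.ncard ≤ Y.ncard) :
    Nat.card V ≤ G.metricLines.ncard := by
  obtain ⟨y₀, hy₀, z₀, -, hX⟩ := h.exists_family_X hU
  obtain ⟨A, hA, hc, -⟩ := exists_family_union hX (h.exists_family_YZ hU hle hy₀ z₀)
    (fun L h1 h2 => h2 h1)
  have hcov : (Set.univ : Set V) ⊆ X ∪ (Y ∪ Z) := fun v _ => h.cover v
  have h1 := Set.ncard_le_ncard hcov (Set.toFinite _)
  have h2 := Set.ncard_union_le X (Y ∪ Z)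
  have h3 := Set.ncard_union_le Y Z
  have h4 := Set.ncard_le_ncard hA (Set.toFinite _)
  rw [Set.ncard_univ] at h1
  omega

theorem card_le_ncard_metricLines [Finite V] (h : G.IsBisplitWith X Y Z)
    (hU : ∀ a b, a ≠ b → G.metricLine a b ≠ Set.univ) :
    Nat.card V ≤ G.metricLines.ncard := by
  rcases le_total Z.ncard Y.ncard with hle | hle
  · exact h.card_le_ncard_metricLines_of_le hU hle
  · exact h.swap.card_le_ncard_metricLines_of_le hU hle

end IsBisplitWith

/-! ### The bipartite case and the conclusion. -/

/-- The distances from any vertex to the two ends of an edge have different parities and differ by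
at most 1, hence by exactly 1. -/
theorem Connected.hasUniversalLine_of_coloring [Nontrivial V] (hG : G.Connected)
    (c : G.Coloring Bool) : G.HasUniversalLine := by
  obtain ⟨u, v, huv⟩ := exists_pair_ne V
  obtain ⟨k, hk⟩ := Nat.exists_eq_succ_of_ne_zero (hG.pos_dist_of_ne huv).ne'
  obtain ⟨w, hw, -⟩ := hG.exists_adj_dist_eq hk
  refine ⟨_, metricLine_mem_metricLines hw.ne, ?_⟩
  rw [Set.eq_univ_iff_forall]
  intro x
  have h1 := dist_eq_one_iff_adj.2 hw
  have t1 := hG.dist_triangle (u := u) (v := w) (w := x)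
  have t2 := hG.dist_triangle (u := w) (v := u) (w := x)
  rw [G.dist_comm (u := w) (v := u)] at t2
  have hpar : G.dist u x ≠ G.dist w x := by
    intro e
    obtain ⟨p, hp⟩ := hG.exists_walk_length_eq_dist u x
    obtain ⟨q, hq⟩ := hG.exists_walk_length_eq_dist w x
    have e1 := c.even_length_iff_congr p
    have e2 := c.even_length_iff_congr q
    have e3 := c.valid hw
    rw [hp, e, ← hq, e2] at e1
    cases h1 : c u <;> cases h2 : c w <;> cases h3 : c x <;> simp_all
  rw [mem_metricLine]
  omega

theorem exists_coloring_of_two_stable {X Y : Set V} (hcov : ∀ v, v ∈ X ∨ v ∈ Y)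
    (hX : ∀ u ∈ X, ∀ v ∈ X, ¬ G.Adj u v) (hY : ∀ u ∈ Y, ∀ v ∈ Y, ¬ G.Adj u v) :
    Nonempty (G.Coloring Bool) := by
  classical
  refine ⟨Coloring.mk (fun v => decide (v ∈ X)) ?_⟩
  intro u v huv e
  have e' : u ∈ X ↔ v ∈ X := by simpa using e
  by_cases hu : u ∈ X
  · exact hX u hu v (e'.1 hu) huv
  · exact hY u ((hcov u).resolve_left hu) v ((hcov v).resolve_left fun hv => hu (e'.2 hv)) huv

end SimpleGraph

theorem theorem1 (n : ℕ) (hn : 2 ≤ n) {V : Type*} [Fintype V] (hV : Fintype.card V = n)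
    (G : SimpleGraph V) (hconn : G.Connected) (hbis : G.IsBisplit) :
    G.HasUniversalLine ∨ n ≤ G.metricLines.ncard := by
  have : Nontrivial V := Fintype.one_lt_card_iff_nontrivial.1 (by omega)
  obtain ⟨X, Y, Z, hcov, hXY, hXZ, hYZ, hX, hY, hZ, hc⟩ := hbis
  have stable : ∀ {S : Set V}, G.IsIndepSet S → ∀ u ∈ S, ∀ v ∈ S, ¬ G.Adj u v :=
    fun hS u hu v hv ha => hS hu hv ha.ne ha
  have cover : ∀ v, v ∈ X ∨ v ∈ Y ∨ v ∈ Z := by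
    intro v
    have hv : v ∈ X ∪ Y ∪ Z := hcov ▸ Set.mem_univ v
    rcases hv with (hv | hv) | hv
    exacts [Or.inl hv, Or.inr (Or.inl hv), Or.inr (Or.inr hv)]
  rcases Y.eq_empty_or_nonempty with hY0 | hY0
  · obtain ⟨c⟩ := SimpleGraph.exists_coloring_of_two_stable (G := G) (X := X) (Y := Z)
      (fun v => by simpa [hY0] using cover v) (stable hX) (stable hZ)
    exact Or.inl (hconn.hasUniversalLine_of_coloring c)
  rcases Z.eq_empty_or_nonempty with hZ0 | hZ0
  · obtain ⟨c⟩ := SimpleGraph.exists_coloring_of_two_stable (G := G) (X := X) (Y := Y)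
      (fun v => by simpa [hZ0] using cover v) (stable hX) (stable hY)
    exact Or.inl (hconn.hasUniversalLine_of_coloring c)
  have h : G.IsBisplitWith X Y Z :=
    { conn := hconn
      cover := cover
      disjXY := fun v h1 h2 => Set.disjoint_left.1 hXY h1 h2
      disjXZ := fun v h1 h2 => Set.disjoint_left.1 hXZ h1 h2
      disjYZ := fun v h1 h2 => Set.disjoint_left.1 hYZ h1 h2
      stableX := stable hX
      stableY := stable hY
      stableZ := stable hZ
      complete := hc
      neY := hY0
      neZ := hZ0 }
  by_cases hU : ∃ a b, a ≠ b ∧ G.metricLine a b = Set.univ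
  · obtain ⟨a, b, hne, e⟩ := hU
    exact Or.inl ⟨_, SimpleGraph.metricLine_mem_metricLines hne, e⟩
  · push Not at hU
    right
    rw [← hV, ← Nat.card_eq_fintype_card]
    exact h.card_le_ncard_metricLines hU
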